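/- Let $N\ge 3$ be an integer, let $\chi$ be a primitive Dirichlet character modulo $N$, and put $$\Phi_N(x;\chi)=\frac{\sum_{n=1}^{N-1}\chi(n)e^{2\pi nx/\sqrt N}}{1-e^{2\pi\sqrt N x}}\quad(x\in\mathbb R,\ x\neq 0),\qquad \Phi_N(0;\chi)=-\frac1N\sum_{n=1}^{N-1}n\chi(n),$$ the value at $0$ being the limit there. For $z\in\mathbb C$ and $\tau\in\mathbb C$ with $\operatorname{Im}\tau>0$ let $$h_N(z;\tau,\chi)=\int_{-\infty}^{\infty}\Phi_N(x;\chi)\,e^{\pi i\tau x^2-2\pi zx}\,dx,\qquad g(\chi)=\sum_{k=1}^{N-1}\chi(k)e^{2\pi ik/N}.$$ Let $\sqrt{\cdot}$ denote the principal branch of the square root. (1) We have $g(\overline\chi)\neq 0$, the integral defining $h_N(z;\tau,\chi)$ converges absolutely, and $$h_N\left(\frac z\tau;-\frac1\tau,\chi\right)=\frac{i\sqrt N}{g(\overline\chi)}\,e^{-\pi iz^2/\tau}\sqrt{-i\tau}\;h_N(-z;\tau,\overline\chi)$$ for all $z\in\mathbb C$ and all $\tau$ with $\operatorname{Im}\tau>0$.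 (2) If $\chi_N(n)=\left(\frac{-N}{n}\right)$ $(n\in\mathbb Z)$, the Kronecker symbol, is a primitive Dirichlet character modulo $N$, then $$h_N\left(\frac z\tau;-\frac1\tau,\chi_N\right)=e^{-\pi iz^2/\tau}\sqrt{-i\tau}\;h_N(z;\tau,\chi_N)$$ for all $z\in\mathbb C$ and all $\tau$ with $\operatorname{Im}\tau>0$. -/

import Mathlib

open MeasureTheory

noncomputable section

namespace TwistedMordell

/-- The `χ`-twisted geometric series `φ_N(t; χ) = (∑_{n=1}^{N-1} χ(n) tⁿ) / (1 - t^N)`.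
For a non-principal character the numerator vanishes at `t = 1`, so the singularity there is
removable; at `t = 1` the function takes its limit `-(1/N) ∑_{n=1}^{N-1} n χ(n)`. -/
def phi {N : ℕ} (χ : DirichletCharacter ℂ N) (t : ℂ) : ℂ :=
  if t = 1 then -(1 / (N : ℂ)) * ∑ n ∈ Finset.Ico 1 N, (n : ℂ) * χ (n : ZMod N)
  else (∑ n ∈ Finset.Ico 1 N, χ (n : ZMod N) * t ^ n) / (1 - t ^ N)

/-- `Φ_N(x; χ) = φ_N(e^{2πx/√N}; χ)`. -/
def Phi {N : ℕ} (χ : DirichletCharacter ℂ N) (x : ℝ) : ℂ :=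
  phi χ (Complex.exp (2 * Real.pi * x / Real.sqrt N))

/-- The integrand `Φ_N(x; χ) e^{πiτx² - 2πzx}`. -/
def integrand {N : ℕ} (χ : DirichletCharacter ℂ N) (z τ : ℂ) (x : ℝ) : ℂ :=
  Phi χ x * Complex.exp (Real.pi * Complex.I * τ * (x : ℂ) ^ 2 - 2 * Real.pi * z * x)

/-- The character-twisted Mordell integral
`h_N(z; τ, χ) = ∫_{-∞}^{∞} Φ_N(x; χ) e^{πiτx² - 2πzx} dx`. -/
def h {N : ℕ} (χ : DirichletCharacter ℂ N) (z τ : ℂ) : ℂ :=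
  ∫ x : ℝ, integrand χ z τ x

/-- The Gauss sum `g(χ) = ∑_{k=1}^{N-1} χ(k) e^{2πik/N}`. -/
def gauss {N : ℕ} (χ : DirichletCharacter ℂ N) : ℂ :=
  ∑ k ∈ Finset.Ico 1 N, χ (k : ZMod N) * Complex.exp (2 * Real.pi * Complex.I * k / N)

/-- The Kronecker symbol `(a / n)` for integers `a` and `n`. It is the completely multiplicative
extension in `n` of the Jacobi symbol with `(a / -1) = -1` if `a < 0` and `1` otherwise,
`(a / 2) = 0` if `a` is even, `1` if `a ≡ ±1 (mod 8)`, `-1` if `a ≡ ±3 (mod 8)`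
(this is the value of `ZMod.χ₈` at `a`), and `(a / 0) = 1` if `a = ±1` and `0` otherwise. -/
def kroneckerSymbol (a n : ℤ) : ℤ :=
  if n = 0 then (if a.natAbs = 1 then 1 else 0)
  else (if n < 0 ∧ a < 0 then -1 else 1)
    * ZMod.χ₈ (a : ZMod 8) ^ (n.natAbs.factorization 2)
    * jacobiSym a (n.natAbs / 2 ^ (n.natAbs.factorization 2))

end TwistedMordell

end

/-! For the functional equation, put `t = e^{2πx/√N}`. Primitivity turns `phi χ t` into a
combination, with coefficients `χ̄(k) / g(χ̄)`, of the simple fractions `1 / (1 - ζᵏ t)`, where `ζ =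
e^{2πi/N}`. The Fourier transform in `x` is then a Mellin transform in `t` on the line `Re s = 0`,
and the Mellin transform of `1 / (1 + c t)` is `c^{-s} π / sin (π s)`. Summing over `k` gives the
same kind of geometric quotient again: up to the factor `i√N / g(χ̄)`, the Fourier transform of `Phi
χ` is the reflection of `Phi (star χ)` (`fourier_Phi`). Moving the Fourier transform from `Phi χ`
onto the Gaussian in `∫ 𝓕Φ · G = ∫ Φ · 𝓕G` yields the transformation law (`h_neg_div`).

For the Kronecker character, `χ` is real and odd, so `h` is even in `z`, and what remains is the
sign of the Gauss sum: `g = i√N`. As `g² = -N`, it suffices that `Im g ≥ 0`. Now `g` times the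
number of units modulo `N` equals `∑ χ(a) ∑ e(a x² / N)`, and by Dirichlet's theorem each unit `a`
is the class of an odd prime `p`, where `χ(p)` is the Jacobi symbol of `-N` over `p`. The
Landsberg–Schaar identity, obtained from theta asymptotics at cusps, evaluates each such term and
shows that its imaginary part is nonnegative (`gauss_of_kroneckerSymbol`). -/

open DirichletCharacter

/-! ### The Mellin transform of `1 / (1 + c t)` for `c` in the slit plane. -/

open Complex Set Filter Topology in
theorem exists_le_norm_one_add_mul {c₀ : ℂ} (hc : c₀ ∈ slitPlane) :
    ∃ δ > 0, ∃ ε > 0, ∀ c ∈ Metric.ball c₀ ε, ∀ w : ℝ, 0 ≤ w → δ * (1 + w) ≤ ‖1 + c * w‖ := by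
  -- The quotient `(1 + c₀ w) / (1 + w)` lies on the segment from `c₀` to `1`, with parameter `l = 1
  -- / (1 + w)`. This segment is compact and misses `0`; `x` is its point closest to `0`.
  have hK : IsCompact ((fun l : ℝ => (l : ℂ) + (1 - l) * c₀) '' Icc 0 1) :=
    isCompact_Icc.image (by fun_prop)
  have hne : ((fun l : ℝ => (l : ℂ) + (1 - l) * c₀) '' Icc 0 1).Nonempty :=
    ⟨_, ⟨0, by simp, rfl⟩⟩
  obtain ⟨x, hx, hmin⟩ := hK.exists_isMinOn hne (f := fun x : ℂ => ‖x‖) (by fun_prop)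
  have hx0 : 0 < ‖x‖ := by
    obtain ⟨l, hl, rfl⟩ := hx
    refine norm_pos_iff.2 fun h => ?_
    rcases eq_or_lt_of_le hl.2 with h1 | h1
    · simp [h1] at h
    · have hre := congrArg re h
      have him := congrArg im h
      simp at hre him
      have h2 : 0 < 1 - l := by linarith
      rcases hc with hc | hc
      · nlinarith [hl.1, mul_pos h2 hc]
      · rcases him with h3 | h3
        · linarith
        · exact hc h3
  -- Half of the minimum `‖x‖` pays for replacing `c₀` by a nearby `c`; the other half is the bound.
  refine ⟨‖x‖ / 2, by positivity, ‖x‖ / 2, by positivity, fun c hcb w hw => ?_⟩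
  have h1 : ‖x‖ * (1 + w) ≤ ‖1 + c₀ * w‖ := by
    have hw1 : (0:ℝ) < 1 + w := by linarith
    have := hmin (mem_image_of_mem (fun l : ℝ => (l : ℂ) + (1 - l) * c₀)
      (show (1 + w)⁻¹ ∈ Icc (0:ℝ) 1 from ⟨by positivity, inv_le_one_of_one_le₀ (by linarith)⟩))
    have hw2 : (1 + (w:ℂ)) ≠ 0 := by exact_mod_cast hw1.ne'
    have e : (((1 + w)⁻¹ : ℝ) : ℂ) + (1 - ((1 + w)⁻¹ : ℝ)) * c₀
        = (1 + c₀ * w) / ((1 + w : ℝ) : ℂ) := by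
      push_cast
      field_simp
      ring
    simp only [mem_ofPred, e, norm_div, norm_real, Real.norm_of_nonneg hw1.le] at this
    rwa [le_div_iff₀ hw1] at this
  have h2 : ‖(c - c₀) * w‖ ≤ ‖x‖ / 2 * (1 + w) := by
    rw [norm_mul, norm_real, Real.norm_of_nonneg hw]
    have := (mem_ball_iff_norm.1 hcb).le
    gcongr
    linarith
  have h3 : 1 + c₀ * w = (1 + c * w) - (c - c₀) * w := by ring
  have h4 := norm_sub_le (1 + c * (w:ℂ)) ((c - c₀) * w)
  rw [← h3] at h4
  linarith

open Complex Set Filter Topology in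
theorem one_add_mul_ne_zero {c : ℂ} (hc : c ∈ slitPlane) {t : ℝ} (ht : 0 ≤ t) : 1 + c * t ≠ 0 := by
  obtain ⟨δ, hδ, ε, hε, H⟩ := exists_le_norm_one_add_mul hc
  have := H c (Metric.mem_ball_self hε) t ht
  exact norm_pos_iff.1 (lt_of_lt_of_le (by positivity) this)

open Complex Set Filter Topology in
theorem norm_inv_one_add_mul_le {c : ℂ} {δ t : ℝ} (hδ : 0 < δ) (ht : 0 ≤ t)
    (h : δ * (1 + t) ≤ ‖1 + c * t‖) : ‖(1 + c * t)⁻¹‖ ≤ δ⁻¹ * (1 + t)⁻¹ := by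
  rw [norm_inv, ← mul_inv]
  exact inv_anti₀ (by positivity) h

open Complex Set Filter Topology in
theorem mellinConvergent_inv_one_add {s : ℂ} (h0 : 0 < s.re) (h1 : s.re < 1) :
    MellinConvergent (fun t : ℝ => ((1 + t : ℝ) : ℂ)⁻¹) s := by
  have hcont : ContinuousOn (fun t : ℝ => ((1 + t : ℝ) : ℂ)⁻¹) (Ioi 0) := by
    refine ContinuousOn.inv₀ (by fun_prop) fun t ht => ?_
    have : (0:ℝ) < 1 + t := by have := mem_Ioi.1 ht; linarith
    exact_mod_cast this.ne'
  refine mellinConvergent_of_isBigO_rpow (a := 1) (b := 0)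
    (hcont.locallyIntegrableOn measurableSet_Ioi) ?_ h1 ?_ h0
  · refine Asymptotics.IsBigO.of_bound 1 ?_
    filter_upwards [eventually_gt_atTop 0] with t ht
    rw [norm_inv, norm_real, Real.rpow_neg_one, norm_inv, Real.norm_of_nonneg ht.le,
      Real.norm_of_nonneg (by linarith), one_mul]
    exact inv_anti₀ ht (by linarith)
  · refine Asymptotics.IsBigO.of_bound 1 ?_
    filter_upwards [self_mem_nhdsWithin] with t ht
    have ht := mem_Ioi.1 ht
    rw [norm_inv, norm_real, Real.norm_of_nonneg (by linarith)]
    simp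
    exact inv_le_one_of_one_le₀ (by linarith)

-- The substitution `x = t / (1 + t)` turns the integral into `B(s, 1 - s)`, and Euler's reflection
-- formula evaluates that.
open Complex Set Filter Topology in
theorem mellin_inv_one_add {s : ℂ} (h0 : 0 < s.re) (h1 : s.re < 1) :
    mellin (fun t : ℝ => ((1 + t : ℝ) : ℂ)⁻¹) s = Real.pi / sin (Real.pi * s) := by
  have hB : betaIntegral s (1 - s) = Real.pi / sin (Real.pi * s) := by
    have := Gamma_mul_Gamma_eq_betaIntegral (s := s) (t := 1 - s) h0 (by simpa using h1)
    rw [← Gamma_mul_Gamma_one_sub, this]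
    simp
  have himg : (fun t : ℝ => t / (1 + t)) '' Ioi 0 = Ioo 0 1 := by
    ext x
    simp only [mem_image, mem_Ioi, mem_Ioo]
    constructor
    · rintro ⟨t, ht, rfl⟩
      exact ⟨by positivity, (div_lt_one (by positivity)).2 (by linarith)⟩
    · rintro ⟨hx0, hx1⟩
      have h2 : 0 < 1 - x := by linarith
      refine ⟨x / (1 - x), by positivity, ?_⟩
      field_simp
      ring
  have hinj : InjOn (fun t : ℝ => t / (1 + t)) (Ioi 0) := by
    intro a ha b hb hab
    have ha := mem_Ioi.1 ha
    have hb := mem_Ioi.1 hb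
    have h2 : (1 + a) ≠ 0 := by positivity
    have h3 : (1 + b) ≠ 0 := by positivity
    simp only at hab
    rw [div_eq_div_iff h2 h3] at hab
    linarith
  have hder : ∀ t ∈ Ioi (0:ℝ),
      HasDerivWithinAt (fun t : ℝ => t / (1 + t)) (((1 + t) ^ 2)⁻¹) (Ioi 0) t := by
    intro t ht
    have ht := mem_Ioi.1 ht
    have h2 : (1 + t) ≠ 0 := by positivity
    have := ((hasDerivAt_id t).div ((hasDerivAt_id t).const_add 1) h2).hasDerivWithinAt (s := Ioi 0)
    convert! this using 1
    simp only [id]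
    field_simp
    ring
  rw [← hB, betaIntegral, intervalIntegral.integral_of_le zero_le_one, integral_Ioc_eq_integral_Ioo,
    ← himg, integral_image_eq_integral_abs_deriv_smul measurableSet_Ioi hder hinj, mellin]
  refine setIntegral_congr_fun measurableSet_Ioi fun t ht => ?_
  have ht := mem_Ioi.1 ht
  have h2 : (0:ℝ) < 1 + t := by positivity
  have h3 : (1 + (t:ℂ)) ≠ 0 := by exact_mod_cast h2.ne'
  have e1 : (1:ℂ) - ((t / (1 + t) : ℝ) : ℂ) = (((1 + t)⁻¹ : ℝ) : ℂ) := by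
    push_cast
    field_simp
    ring
  have e2 : ((t / (1 + t) : ℝ) : ℂ) ^ (s - 1) = (t:ℂ) ^ (s - 1) * ((1 + t : ℝ) : ℂ) ^ (1 - s) := by
    rw [div_eq_mul_inv, ofReal_mul, mul_cpow_ofReal_nonneg ht.le (by positivity), ofReal_inv,
      inv_cpow _ _ (by rw [arg_ofReal_of_nonneg h2.le]; exact Real.pi_ne_zero.symm), ← cpow_neg,
      neg_sub]
  have e3 : (((1 + t)⁻¹ : ℝ) : ℂ) ^ (1 - s - 1) = ((1 + t : ℝ) : ℂ) ^ s := by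
    rw [ofReal_inv,
      inv_cpow _ _ (by rw [arg_ofReal_of_nonneg h2.le]; exact Real.pi_ne_zero.symm), ← cpow_neg]
    congr 1
    ring
  have e4 : ((1 + t : ℝ) : ℂ) ^ (1 - s) * ((1 + t : ℝ) : ℂ) ^ s = ((1 + t : ℝ) : ℂ) := by
    rw [← cpow_add _ _ (by exact_mod_cast h2.ne'), sub_add_cancel, cpow_one]
  simp only [e1, e2, e3, smul_eq_mul]
  rw [mul_assoc, e4, abs_of_pos (by positivity), real_smul]
  push_cast
  field_simp

-- Differentiation under the integral sign. The derivative in `c` has the extra factor `-t / (1 + c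
-- t)`, which is bounded locally uniformly in `c`, so the integrable bound for the integrand also
-- serves for its derivative.
open Complex Set Filter Topology in
theorem differentiableAt_mellin_inv_one_add_mul {s : ℂ} (h0 : 0 < s.re) (h1 : s.re < 1)
    {c₀ : ℂ} (hc : c₀ ∈ slitPlane) :
    DifferentiableAt ℂ (fun c : ℂ => mellin (fun t : ℝ => (1 + c * t)⁻¹) s) c₀ := by
  obtain ⟨δ, hδ, ε, hε, H⟩ := exists_le_norm_one_add_mul hc
  have hconv := mellinConvergent_inv_one_add h0 h1
  have hne : ∀ c ∈ Metric.ball c₀ ε, ∀ t : ℝ, 0 < t → 1 + c * t ≠ 0 := fun c hc t ht =>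
    norm_pos_iff.1 (lt_of_lt_of_le (by positivity) (H c hc t ht.le))
  have hp : ContinuousOn (fun t : ℝ => (t:ℂ) ^ (s - 1)) (Ioi 0) := fun t ht =>
    (continuousAt_ofReal_cpow_const _ _ (Or.inr (ne_of_gt ht))).continuousWithinAt
  have hcont : ∀ c ∈ Metric.ball c₀ ε,
      ContinuousOn (fun t : ℝ => (t:ℂ) ^ (s - 1) • (1 + c * t)⁻¹) (Ioi 0) := by
    exact fun c hc => hp.smul (ContinuousOn.inv₀ (by fun_prop) fun t ht => hne c hc t ht)
  have hbound : ∀ c ∈ Metric.ball c₀ ε, ∀ t : ℝ, 0 < t →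
      ‖(t:ℂ) ^ (s - 1) • (1 + c * t)⁻¹‖ ≤ δ⁻¹ * ‖(t:ℂ) ^ (s - 1) • ((1 + t : ℝ) : ℂ)⁻¹‖ := by
    intro c hc t ht
    rw [norm_smul, norm_smul, mul_left_comm, norm_inv ((1 + t : ℝ) : ℂ), norm_real,
      Real.norm_of_nonneg (by positivity)]
    gcongr
    exact norm_inv_one_add_mul_le hδ ht.le (H c hc t ht.le)
  refine (hasDerivAt_integral_of_dominated_loc_of_deriv_le (μ := volume.restrict (Ioi 0))
    (F := fun (c : ℂ) (t : ℝ) => (t:ℂ) ^ (s - 1) • (1 + c * t)⁻¹)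
    (F' := fun (c : ℂ) (t : ℝ) => (t:ℂ) ^ (s - 1) • (-t / (1 + c * t) ^ 2))
    (bound := fun t : ℝ => δ⁻¹ * δ⁻¹ * ‖(t:ℂ) ^ (s - 1) • ((1 + t : ℝ) : ℂ)⁻¹‖)
    (Metric.ball_mem_nhds c₀ hε) ?_ ?_ ?_ ?_ ?_ ?_).2.differentiableAt
  · filter_upwards [Metric.ball_mem_nhds c₀ hε] with c hc
    exact (hcont c hc).aestronglyMeasurable measurableSet_Ioi
  · refine (hconv.norm.const_mul δ⁻¹).mono'
      ((hcont c₀ (Metric.mem_ball_self hε)).aestronglyMeasurable measurableSet_Ioi) ?_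
    exact (ae_restrict_mem measurableSet_Ioi).mono fun t ht =>
      hbound c₀ (Metric.mem_ball_self hε) t ht
  · refine ContinuousOn.aestronglyMeasurable ?_ measurableSet_Ioi
    exact hp.smul (ContinuousOn.div (by fun_prop) (by fun_prop) fun t ht =>
      pow_ne_zero 2 (hne c₀ (Metric.mem_ball_self hε) t ht))
  · refine (ae_restrict_mem measurableSet_Ioi).mono fun t ht c hc => ?_
    have ht := mem_Ioi.1 ht
    have e : (t:ℂ) ^ (s - 1) • (-t / (1 + c * t) ^ 2)
        = (-t * (1 + c * t)⁻¹) * ((t:ℂ) ^ (s - 1) • (1 + c * t)⁻¹) := by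
      simp only [smul_eq_mul]
      field_simp
    rw [e, norm_mul, mul_assoc]
    refine mul_le_mul ?_ (hbound c hc t ht) (norm_nonneg _) (by positivity)
    rw [norm_mul, norm_neg, norm_real, Real.norm_of_nonneg ht.le]
    refine (mul_le_mul_of_nonneg_left (norm_inv_one_add_mul_le hδ ht.le (H c hc t ht.le))
      ht.le).trans ?_
    rw [mul_left_comm]
    refine mul_le_of_le_one_right (by positivity) ?_
    rw [← div_eq_mul_inv]
    exact (div_le_one (by positivity)).2 (by linarith)
  · exact hconv.norm.const_mul _
  · refine (ae_restrict_mem measurableSet_Ioi).mono fun t ht c hc => ?_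
    have h2 : HasDerivAt (fun c : ℂ => 1 + c * (t:ℂ)) (t:ℂ) c := by
      simpa using ((hasDerivAt_id c).mul_const (t:ℂ)).const_add 1
    exact (h2.fun_inv (hne c hc t ht)).fun_const_smul _

open Complex Set Filter Topology in
theorem mellinConvergent_inv_one_add_mul {s : ℂ} (h0 : 0 < s.re) (h1 : s.re < 1)
    {c : ℂ} (hc : c ∈ slitPlane) : MellinConvergent (fun t : ℝ => (1 + c * t)⁻¹) s := by
  obtain ⟨δ, hδ, ε, hε, H⟩ := exists_le_norm_one_add_mul hc
  have hp : ContinuousOn (fun t : ℝ => (t:ℂ) ^ (s - 1)) (Ioi 0) := fun t ht =>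
    (continuousAt_ofReal_cpow_const _ _ (Or.inr (ne_of_gt ht))).continuousWithinAt
  have hcont : ContinuousOn (fun t : ℝ => (t:ℂ) ^ (s - 1) • (1 + c * t)⁻¹) (Ioi 0) := by
    exact hp.smul (ContinuousOn.inv₀ (by fun_prop) fun t ht =>
      one_add_mul_ne_zero hc (le_of_lt ht))
  refine ((mellinConvergent_inv_one_add h0 h1).norm.const_mul δ⁻¹).mono'
    (hcont.aestronglyMeasurable measurableSet_Ioi)
    ((ae_restrict_mem measurableSet_Ioi).mono fun t ht => ?_)
  have ht := mem_Ioi.1 ht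
  rw [norm_smul, norm_smul, mul_left_comm, norm_inv ((1 + t : ℝ) : ℂ), norm_real,
    Real.norm_of_nonneg (by positivity)]
  gcongr
  exact norm_inv_one_add_mul_le hδ ht.le (H c (Metric.mem_ball_self hε) t ht.le)

-- For real `c > 0` this is rescaling of the case `c = 1`. Both sides are analytic in `c`, so the
-- identity theorem carries it to the connected slit plane.
open Complex Set Filter Topology in
theorem mellin_inv_one_add_mul {s : ℂ} (h0 : 0 < s.re) (h1 : s.re < 1)
    {c : ℂ} (hc : c ∈ slitPlane) :
    mellin (fun t : ℝ => (1 + c * t)⁻¹) s = c ^ (-s) * (Real.pi / sin (Real.pi * s)) := by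
  have hL : AnalyticOnNhd ℂ (fun c : ℂ => mellin (fun t : ℝ => (1 + c * t)⁻¹) s) slitPlane :=
    DifferentiableOn.analyticOnNhd (fun c hc =>
      (differentiableAt_mellin_inv_one_add_mul h0 h1 hc).differentiableWithinAt) isOpen_slitPlane
  have hR : AnalyticOnNhd ℂ (fun c : ℂ => c ^ (-s) * (Real.pi / sin (Real.pi * s))) slitPlane := by
    refine DifferentiableOn.analyticOnNhd (fun c hc => ?_) isOpen_slitPlane
    exact ((differentiableAt_id.cpow_const hc).mul_const _).differentiableWithinAt
  have hreal : ∀ a : ℝ, 0 < a → mellin (fun t : ℝ => (1 + (a:ℂ) * t)⁻¹) s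
      = (a:ℂ) ^ (-s) * (Real.pi / sin (Real.pi * s)) := by
    intro a ha
    rw [← mellin_inv_one_add h0 h1, ← smul_eq_mul, ← mellin_comp_mul_left _ _ ha]
    simp
  refine hL.eqOn_of_preconnected_of_frequently_eq hR
    (starConvex_one_slitPlane.isPathConnected one_mem_slitPlane).isConnected.isPreconnected
    one_mem_slitPlane ?_ hc
  have ht : Tendsto (fun n : ℕ => ((1 + 1 / ((n:ℝ) + 1) : ℝ) : ℂ)) atTop (𝓝[≠] 1) := by
    refine tendsto_nhdsWithin_iff.2 ⟨?_, Eventually.of_forall fun n => ?_⟩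
    · have := (tendsto_one_div_add_atTop_nhds_zero_nat (𝕜 := ℝ)).const_add 1
      rw [add_zero] at this
      exact (continuous_ofReal.tendsto' (1:ℝ) (1:ℂ) (by simp)).comp this
    · have : (1 + 1 / ((n:ℝ) + 1) : ℝ) ≠ 1 := by
        have : (0:ℝ) < 1 / ((n:ℝ) + 1) := by positivity
        linarith
      rwa [mem_compl_iff, mem_singleton_iff, ← ofReal_one, ofReal_inj]
  exact ht.frequently (Frequently.of_forall fun n => hreal _ (by positivity))

/-! ### Sums over residues and Gauss sums of primitive characters. -/

theorem ZMod.sum_range_natCast {M : Type*} [AddCommMonoid M] {N : ℕ} [NeZero N] (f : ZMod N → M) :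
    ∑ k ∈ Finset.range N, f (k : ZMod N) = ∑ a : ZMod N, f a :=
  Finset.sum_bij' (fun k _ => (k : ZMod N)) (fun a _ => a.val) (by simp)
    (fun a _ => Finset.mem_range.2 a.val_lt)
    (fun k hk => ZMod.val_cast_of_lt (Finset.mem_range.1 hk)) (by simp) (by simp)

theorem ZMod.sum_Ico_one_natCast {M : Type*} [AddCommMonoid M] {N : ℕ} [NeZero N]
    (f : ZMod N → M) (h0 : f 0 = 0) :
    ∑ k ∈ Finset.Ico 1 N, f (k : ZMod N) = ∑ a : ZMod N, f a := by
  rw [← ZMod.sum_range_natCast, Finset.range_eq_Ico,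
    Finset.sum_eq_sum_Ico_succ_bot (Nat.pos_of_ne_zero (NeZero.ne N))]
  simp [h0]

theorem DirichletCharacter.map_zero_of_one_lt {N : ℕ} (hN : 1 < N) (χ : DirichletCharacter ℂ N) :
    χ 0 = 0 := by
  have : Fact (1 < N) := ⟨hN⟩
  exact χ.map_nonunit not_isUnit_zero

theorem DirichletCharacter.IsPrimitive.inv {N : ℕ} {χ : DirichletCharacter ℂ N}
    (hχ : χ.IsPrimitive) : χ⁻¹.IsPrimitive := by
  rw [IsPrimitive] at hχ ⊢
  rw [conductor_inv, hχ]

-- The discrete Fourier transform of `χ` is `k ↦ g(χ) χ⁻¹(-k)`. Transforming twice must give `N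
-- χ(-j)`, and evaluation at `1` gives the product.
open scoped ZMod in
theorem DirichletCharacter.IsPrimitive.gaussSum_mul_gaussSum_inv {N : ℕ} [NeZero N]
    {χ : DirichletCharacter ℂ N} (hχ : χ.IsPrimitive) :
    gaussSum χ ZMod.stdAddChar * gaussSum χ⁻¹ ZMod.stdAddChar = N * χ (-1) := by
  have h1 := congrFun (ZMod.dft_dft (χ : ZMod N → ℂ)) 1
  have h2 : ZMod.dft (χ : ZMod N → ℂ)
      = fun k => (fun j => χ⁻¹ j * gaussSum χ ZMod.stdAddChar) (-k) :=
    funext fun k => hχ.fourierTransform_eq_inv_mul_gaussSum k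
  rw [h2] at h1
  replace h1 := (congrFun (ZMod.dft_comp_neg
    (fun j => χ⁻¹ j * gaussSum χ ZMod.stdAddChar)) 1).symm.trans h1
  simp only [ZMod.dft_mul_const] at h1
  simp only [hχ.inv.fourierTransform_eq_inv_mul_gaussSum, inv_inv, neg_neg, map_one, one_mul,
    smul_eq_mul] at h1
  rw [mul_comm, h1]

theorem DirichletCharacter.IsPrimitive.gaussSum_ne_zero {N : ℕ} [NeZero N]
    {χ : DirichletCharacter ℂ N} (hχ : χ.IsPrimitive) : gaussSum χ ZMod.stdAddChar ≠ 0 := by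
  intro h
  have := hχ.gaussSum_mul_gaussSum_inv
  rw [h, zero_mul] at this
  rcases mul_eq_zero.1 this.symm with h | h
  · exact NeZero.ne N (by exact_mod_cast h)
  · exact (isUnit_one.neg.map χ).ne_zero h

/-! ### Partial fractions and the reflection `t ↦ 1/t` of `phi`. -/

namespace TwistedMordell

theorem gauss_eq_gaussSum {N : ℕ} [NeZero N] (hN : 1 < N) (χ : DirichletCharacter ℂ N) :
    gauss χ = gaussSum χ ZMod.stdAddChar := by
  rw [gaussSum, ← ZMod.sum_Ico_one_natCast _ (by rw [χ.map_zero_of_one_lt hN, zero_mul]), gauss]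
  refine Finset.sum_congr rfl fun k _ => ?_
  have := ZMod.stdAddChar_coe (N := N) (k : ℤ)
  push_cast at this
  rw [this]

theorem sum_star_mul_exp {N : ℕ} [NeZero N] (hN : 1 < N) {χ : DirichletCharacter ℂ N}
    (hχ : χ.IsPrimitive) (j : ℕ) :
    ∑ k ∈ Finset.Ico 1 N, (star χ) (k : ZMod N) * Complex.exp (2 * Real.pi * Complex.I * k / N) ^ j
      = χ (j : ZMod N) * gauss (star χ) := by
  have h := gaussSum_mulShift_of_isPrimitive ZMod.stdAddChar hχ.inv (j : ZMod N)
  rw [inv_inv] at h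
  rw [gauss_eq_gaussSum hN, MulChar.star_eq_inv, ← h, gaussSum,
    ← ZMod.sum_Ico_one_natCast _ (by rw [χ⁻¹.map_zero_of_one_lt hN, zero_mul])]
  refine Finset.sum_congr rfl fun k _ => ?_
  have := ZMod.stdAddChar_coe (N := N) ((j : ℤ) * k)
  push_cast at this
  rw [AddChar.mulShift_apply, this, ← Complex.exp_nat_mul]
  congr 2
  ring

theorem gauss_ne_zero {N : ℕ} (hN : 1 < N) {χ : DirichletCharacter ℂ N}
    (hχ : χ.IsPrimitive) : gauss χ ≠ 0 := by
  have : NeZero N := ⟨by omega⟩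
  rw [gauss_eq_gaussSum hN]
  exact hχ.gaussSum_ne_zero

theorem star_isPrimitive {N : ℕ} {χ : DirichletCharacter ℂ N} (hχ : χ.IsPrimitive) :
    (star χ).IsPrimitive := by
  rw [MulChar.star_eq_inv]
  exact hχ.inv

/-- The partial fraction decomposition of `phi χ`, as a function on the real line. -/
noncomputable def partialFractions {N : ℕ} (χ : DirichletCharacter ℂ N) (t : ℝ) : ℂ :=
  (gauss (star χ))⁻¹ * ∑ k ∈ Finset.Ico 1 N,
    (star χ) (k : ZMod N) * (1 + -Complex.exp (2 * Real.pi * Complex.I * k / N) * t)⁻¹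

/-- Each `1 / (1 - ζᵏ t)` is `(1 - t^N)⁻¹ ∑ ζ^{jk} tʲ` over `j < N`. The sum over `k` weighted by
`χ̄(k)` is a twisted Gauss sum, equal to `χ(j) g(χ̄)` by primitivity. -/
theorem phi_eq_partialFractions {N : ℕ} (hN : 1 < N) {χ : DirichletCharacter ℂ N}
    (hχ : χ.IsPrimitive) {t : ℝ} (ht0 : 0 < t) (ht : t ≠ 1) : phi χ t = partialFractions χ t := by
  have : NeZero N := ⟨by omega⟩
  have hg := gauss_ne_zero hN (star_isPrimitive hχ)
  have htN : 1 - (t:ℂ) ^ N ≠ 0 := by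
    intro h
    have h2 : t ^ N = 1 := by
      have := (sub_eq_zero.1 h).symm
      exact_mod_cast this
    exact ht ((pow_eq_one_iff_of_nonneg ht0.le (by omega)).1 h2)
  have hinv : ∀ k : ℕ, (1 + -Complex.exp (2 * Real.pi * Complex.I * k / N) * t)⁻¹
      = (1 - (t:ℂ) ^ N)⁻¹ * ∑ j ∈ Finset.range N,
        (t:ℂ) ^ j * Complex.exp (2 * Real.pi * Complex.I * k / N) ^ j := by
    intro k
    set w := Complex.exp (2 * Real.pi * Complex.I * k / N)
    have hw : w ^ N = 1 := by
      rw [← Complex.exp_nat_mul, mul_div_cancel₀ _ (NeZero.ne (N:ℂ)), mul_comm]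
      exact Complex.exp_nat_mul_two_pi_mul_I k
    have h1 : (1 + -w * t) * ∑ j ∈ Finset.range N, (t:ℂ) ^ j * w ^ j = 1 - (t:ℂ) ^ N := by
      have := mul_neg_geom_sum ((t:ℂ) * w) N
      simp only [mul_pow, hw, mul_one] at this
      rw [← this]
      ring
    refine inv_eq_of_mul_eq_one_right ?_
    rw [mul_left_comm, h1, inv_mul_cancel₀ htN]
  have ht' : (t:ℂ) ≠ 1 := by exact_mod_cast ht
  rw [phi, if_neg ht', partialFractions]
  simp_rw [hinv]
  have : ∀ k ∈ Finset.Ico 1 N, (star χ) (k : ZMod N) * ((1 - (t:ℂ) ^ N)⁻¹ *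
      ∑ j ∈ Finset.range N, (t:ℂ) ^ j * Complex.exp (2 * Real.pi * Complex.I * k / N) ^ j)
      = ∑ j ∈ Finset.range N, (1 - (t:ℂ) ^ N)⁻¹ * (t:ℂ) ^ j *
        ((star χ) (k : ZMod N) * Complex.exp (2 * Real.pi * Complex.I * k / N) ^ j) := by
    intro k _
    rw [Finset.mul_sum, Finset.mul_sum]
    exact Finset.sum_congr rfl fun j _ => by ring
  rw [Finset.sum_congr rfl this, Finset.sum_comm]
  simp_rw [← Finset.mul_sum, sum_star_mul_exp hN hχ]
  rw [Finset.range_eq_Ico, Finset.sum_eq_sum_Ico_succ_bot (a := 0) (b := N) (by omega)]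
  simp only [Nat.cast_zero, χ.map_zero_of_one_lt hN, zero_mul, mul_zero, zero_add, Finset.mul_sum,
    Finset.sum_div]
  refine Finset.sum_congr rfl fun j _ => ?_
  field_simp

/-- Multiplying the numerator by `t^N` and substituting `n ↦ N - n` brings out `χ(-1)`; the minus
sign comes from the denominator. -/
theorem phi_inv {N : ℕ} (χ : DirichletCharacter ℂ N) {t : ℂ} (ht0 : t ≠ 0) (ht : t ≠ 1)
    (htN : t ^ N ≠ 1) : phi χ t⁻¹ = -χ (-1) * phi χ t := by
  have ht' : t⁻¹ ≠ 1 := by simpa using ht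
  have h1 : 1 - t ^ N ≠ 0 := sub_ne_zero.2 htN.symm
  have h2 : 1 - t⁻¹ ^ N = -(1 - t ^ N) / t ^ N := by
    rw [inv_pow]
    field_simp
    ring
  rw [phi, phi, if_neg ht, if_neg ht', h2, mul_div_assoc', eq_div_iff h1, div_div_eq_mul_div,
    div_mul_eq_mul_div, div_eq_iff (neg_ne_zero.2 h1)]
  have h3 : (∑ n ∈ Finset.Ico 1 N, χ (n : ZMod N) * t⁻¹ ^ n) * t ^ N
      = χ (-1) * ∑ n ∈ Finset.Ico 1 N, χ (n : ZMod N) * t ^ n := by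
    rw [Finset.sum_mul, Finset.mul_sum]
    refine Finset.sum_bij' (fun n _ => N - n) (fun n _ => N - n) ?_ ?_ ?_ ?_ ?_
    · intro n hn; simp only [Finset.mem_Ico] at hn ⊢; omega
    · intro n hn; simp only [Finset.mem_Ico] at hn ⊢; omega
    · intro n hn; simp only [Finset.mem_Ico] at hn ⊢; omega
    · intro n hn; simp only [Finset.mem_Ico] at hn ⊢; omega
    · intro n hn
      simp only [Finset.mem_Ico] at hn
      rw [Nat.cast_sub hn.2.le, ← mul_assoc, ← map_mul, pow_sub₀ _ ht0 hn.2.le, inv_pow]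
      simp
      ring
  rw [h3]
  ring

theorem Phi_neg {N : ℕ} (hN : 1 < N) (χ : DirichletCharacter ℂ N) {x : ℝ} (hx : x ≠ 0) :
    Phi χ (-x) = -χ (-1) * Phi χ x := by
  have hs : (0:ℝ) < Real.sqrt N := Real.sqrt_pos.2 (by exact_mod_cast (by omega : 0 < N))
  have h1 : ∀ c : ℝ, c ≠ 0 → Complex.exp (c:ℂ) ≠ 1 := by
    intro c hc
    rw [← Complex.ofReal_exp, ← Complex.ofReal_one, Ne, Complex.ofReal_inj, Real.exp_eq_one_iff]
    exact hc
  rw [Phi, Phi, ← phi_inv χ (Complex.exp_ne_zero _), ← Complex.exp_neg]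
  · congr 2
    push_cast
    ring
  · have := h1 (2 * Real.pi * x / Real.sqrt N) (by positivity)
    simpa using this
  · have := h1 (N * (2 * Real.pi * x / Real.sqrt N)) (by
      have : (N:ℝ) ≠ 0 := by exact_mod_cast (by omega : N ≠ 0)
      positivity)
    rw [← Complex.exp_nat_mul]
    simpa using this

end TwistedMordell

/-! ### The Mellin transform of the partial fractions, up to the line `Re s = 0`. -/

namespace TwistedMordell

open Complex Set Filter Topology

/-- The angle `2πk/N - π` lies in `(-π, π)` for `0 < k < N`, so it is the principal argument and
computes the complex powers of `-ζᵏ`. -/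
theorem neg_exp_eq (N k : ℕ) :
    -exp (2 * Real.pi * I * k / N) = exp (((2 * Real.pi * k / N - Real.pi : ℝ) : ℂ) * I) := by
  have h : (2 * Real.pi * I * k / N : ℂ)
      = ((2 * Real.pi * k / N - Real.pi : ℝ) : ℂ) * I + Real.pi * I := by
    push_cast
    ring
  rw [h, exp_add, exp_pi_mul_I]
  ring

theorem angle_mem {N k : ℕ} (hk : k ∈ Finset.Ico 1 N) :
    (2 * Real.pi * k / N - Real.pi : ℝ) ∈ Ioo (-Real.pi) Real.pi := by
  obtain ⟨h1, h2⟩ := Finset.mem_Ico.1 hk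
  have hN : (0:ℝ) < N := by exact_mod_cast (by omega : 0 < N)
  have hk0 : (0:ℝ) < k := by exact_mod_cast (by omega : 0 < k)
  have hkN : (k:ℝ) < N := by exact_mod_cast h2
  have := Real.pi_pos
  constructor
  · have : 0 < 2 * Real.pi * k / N := by positivity
    linarith
  · have : 2 * Real.pi * k / N < 2 * Real.pi := by
      rw [div_lt_iff₀ hN]
      gcongr
    linarith

theorem neg_exp_mem_slitPlane {N k : ℕ} (hk : k ∈ Finset.Ico 1 N) :
    -exp (2 * Real.pi * I * k / N) ∈ slitPlane := by
  have hN : N ≠ 0 := by have := Finset.mem_Ico.1 hk; omega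
  have h := angle_mem hk
  rw [neg_exp_eq, mem_slitPlane_iff_arg, arg_exp_mul_I,
    (toIocMod_eq_self Real.two_pi_pos).2 ⟨h.1, by linarith [h.2]⟩]
  exact ⟨h.2.ne, exp_ne_zero _⟩

theorem neg_exp_cpow {N k : ℕ} (hk : k ∈ Finset.Ico 1 N) (s : ℂ) :
    (-exp (2 * Real.pi * I * k / N)) ^ s
      = exp (((2 * Real.pi * k / N - Real.pi : ℝ) : ℂ) * I * s) := by
  have hN : N ≠ 0 := by have := Finset.mem_Ico.1 hk; omega
  have h := angle_mem hk
  rw [neg_exp_eq, cpow_def_of_ne_zero (exp_ne_zero _), log_exp (by simpa using h.1)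
    (by simpa using h.2.le)]

theorem sum_star_eq_zero {N : ℕ} (hN : 3 ≤ N) {χ : DirichletCharacter ℂ N} (hχ : χ.IsPrimitive) :
    ∑ k ∈ Finset.Ico 1 N, (star χ) (k : ZMod N) = 0 := by
  have : NeZero N := ⟨by omega⟩
  have h := sum_star_mul_exp (by omega) hχ 0
  simpa [χ.map_zero_of_one_lt (by omega : 1 < N)] using h

/-- As `∑ χ̄(k) = 0`, the value `1` at `t = 0` may be subtracted from every fraction. This exhibits
the decay `O(t)` at `0`, which extends the Mellin transform to the left of `Re s = 0`. -/
theorem partialFractions_eq_sub {N : ℕ} (hN : 3 ≤ N) {χ : DirichletCharacter ℂ N}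
    (hχ : χ.IsPrimitive) (t : ℝ) (ht : 0 ≤ t) :
    partialFractions χ t = (gauss (star χ))⁻¹ * ∑ k ∈ Finset.Ico 1 N, (star χ) (k : ZMod N) *
      (exp (2 * Real.pi * I * k / N) * t * (1 + -exp (2 * Real.pi * I * k / N) * t)⁻¹) := by
  have h : ∀ k ∈ Finset.Ico 1 N, (star χ) (k : ZMod N) *
      (exp (2 * Real.pi * I * k / N) * t * (1 + -exp (2 * Real.pi * I * k / N) * t)⁻¹)
      = (star χ) (k : ZMod N) * (1 + -exp (2 * Real.pi * I * k / N) * t)⁻¹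
        - (star χ) (k : ZMod N) := by
    intro k hk
    have := one_add_mul_ne_zero (neg_exp_mem_slitPlane hk) ht
    linear_combination -(star χ) (k : ZMod N) * mul_inv_cancel₀ this
  rw [Finset.sum_congr rfl h, Finset.sum_sub_distrib, sum_star_eq_zero hN hχ, sub_zero,
    partialFractions]

theorem exists_norm_inv_le (N : ℕ) : ∃ C : ℝ, 0 < C ∧ ∀ k ∈ Finset.Ico 1 N, ∀ t : ℝ, 0 ≤ t →
    ‖(1 + -exp (2 * Real.pi * I * k / N) * t)⁻¹‖ ≤ C * (1 + t)⁻¹ := by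
  have : ∀ k : ℕ, ∃ C : ℝ, 0 < C ∧ (k ∈ Finset.Ico 1 N → ∀ t : ℝ, 0 ≤ t →
      ‖(1 + -exp (2 * Real.pi * I * k / N) * t)⁻¹‖ ≤ C * (1 + t)⁻¹) := by
    intro k
    by_cases hk : k ∈ Finset.Ico 1 N
    · obtain ⟨δ, hδ, ε, hε, H⟩ := exists_le_norm_one_add_mul (neg_exp_mem_slitPlane hk)
      exact ⟨δ⁻¹, by positivity, fun _ t ht =>
        norm_inv_one_add_mul_le hδ ht (H _ (Metric.mem_ball_self hε) t ht)⟩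
    · exact ⟨1, one_pos, fun h => absurd h hk⟩
  choose C hC H using this
  refine ⟨1 + ∑ k ∈ Finset.Ico 1 N, C k,
    add_pos_of_pos_of_nonneg one_pos (Finset.sum_nonneg fun k _ => (hC k).le), fun k hk t ht => ?_⟩
  refine (H k hk t ht).trans ?_
  have := Finset.single_le_sum (f := C) (fun k _ => (hC k).le) hk
  gcongr
  linarith

theorem exists_norm_partialFractions_le {N : ℕ} (hN : 3 ≤ N) {χ : DirichletCharacter ℂ N}
    (hχ : χ.IsPrimitive) : ∃ C : ℝ, 0 < C ∧ ∀ t : ℝ, 0 ≤ t →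
      ‖partialFractions χ t‖ ≤ C * (1 + t)⁻¹ ∧ ‖partialFractions χ t‖ ≤ C * t := by
  obtain ⟨C, hC, H⟩ := exists_norm_inv_le N
  have hg : 0 < ‖(gauss (star χ))⁻¹‖ :=
    norm_pos_iff.2 (inv_ne_zero (gauss_ne_zero (by omega) (star_isPrimitive hχ)))
  have hN0 : (0:ℝ) < N := by exact_mod_cast (by omega : 0 < N)
  refine ⟨‖(gauss (star χ))⁻¹‖ * (N * C), by positivity, fun t ht => ⟨?_, ?_⟩⟩
  · rw [partialFractions, norm_mul, mul_assoc ‖(gauss (star χ))⁻¹‖]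
    refine mul_le_mul_of_nonneg_left ?_ hg.le
    refine (norm_sum_le_of_le (Finset.Ico 1 N) (f := fun k : ℕ => (star χ) (k : ZMod N) *
      (1 + -exp (2 * Real.pi * I * k / N) * t)⁻¹) (n := fun _ => C * (1 + t)⁻¹) ?_).trans ?_
    · intro k hk
      rw [norm_mul]
      exact (mul_le_of_le_one_left (norm_nonneg _) ((star χ).norm_le_one _)).trans (H k hk t ht)
    · rw [Finset.sum_const, Nat.card_Ico, nsmul_eq_mul, mul_assoc]
      gcongr
      exact Nat.sub_le _ _
  · rw [partialFractions_eq_sub hN hχ t ht, norm_mul, mul_assoc ‖(gauss (star χ))⁻¹‖]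
    refine mul_le_mul_of_nonneg_left ?_ hg.le
    refine (norm_sum_le_of_le (Finset.Ico 1 N) (f := fun k : ℕ => (star χ) (k : ZMod N) *
      (exp (2 * Real.pi * I * k / N) * t * (1 + -exp (2 * Real.pi * I * k / N) * t)⁻¹))
      (n := fun _ => C * t) ?_).trans ?_
    · intro k hk
      have h1 : ‖exp (2 * Real.pi * I * k / N)‖ = 1 := by
        rw [show (2 * Real.pi * I * k / N : ℂ) = ((2 * Real.pi * k / N : ℝ) : ℂ) * I by
          push_cast; ring]
        exact norm_exp_ofReal_mul_I _
      rw [norm_mul]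
      refine (mul_le_of_le_one_left (norm_nonneg _) ((star χ).norm_le_one _)).trans ?_
      rw [norm_mul, norm_mul, h1, one_mul, norm_real, Real.norm_of_nonneg ht, mul_comm C]
      refine mul_le_mul_of_nonneg_left ((H k hk t ht).trans ?_) ht
      exact mul_le_of_le_one_right hC.le (inv_le_one_of_one_le₀ (by linarith))
    · rw [Finset.sum_const, Nat.card_Ico, nsmul_eq_mul, mul_assoc]
      gcongr
      exact Nat.sub_le _ _

theorem continuousOn_partialFractions {N : ℕ} (χ : DirichletCharacter ℂ N) :
    ContinuousOn (partialFractions χ) (Ici 0) := by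
  refine continuousOn_const.mul (continuousOn_finsetSum _ fun k hk => continuousOn_const.mul ?_)
  exact ContinuousOn.inv₀ (by fun_prop) fun t ht =>
    one_add_mul_ne_zero (neg_exp_mem_slitPlane hk) ht

theorem sin_pi_mul_ne_zero {s : ℂ} (hs : s ≠ 0) (h0 : -1 < s.re) (h1 : s.re < 1) :
    sin (Real.pi * s) ≠ 0 := by
  rw [Ne, sin_eq_zero_iff]
  rintro ⟨n, hn⟩
  have hpi : (Real.pi : ℂ) ≠ 0 := by exact_mod_cast Real.pi_ne_zero
  have hsn : s = n := mul_left_cancel₀ hpi (by rw [hn]; ring)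
  rw [hsn, intCast_re] at h0 h1
  have a : -1 < n := by exact_mod_cast h0
  have b : n < 1 := by exact_mod_cast h1
  obtain rfl : n = 0 := by omega
  exact hs (by simpa using hsn)

theorem mellin_partialFractions_of_re_pos {N : ℕ} (χ : DirichletCharacter ℂ N) {s : ℂ}
    (h0 : 0 < s.re) (h1 : s.re < 1) :
    mellin (partialFractions χ) s = (gauss (star χ))⁻¹ * (∑ k ∈ Finset.Ico 1 N,
      (star χ) (k : ZMod N) * exp (((2 * Real.pi * k / N - Real.pi : ℝ) : ℂ) * I * -s))
        * (Real.pi / sin (Real.pi * s)) := by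
  have hpf : partialFractions χ = fun t : ℝ => (gauss (star χ))⁻¹ • ∑ k ∈ Finset.Ico 1 N,
    (star χ) (k : ZMod N) • (1 + -exp (2 * Real.pi * I * k / N) * t)⁻¹ := rfl
  rw [hpf, mellin_const_smul, smul_eq_mul, mul_assoc (gauss (star χ))⁻¹]
  congr 1
  rw [Finset.sum_mul]
  simp only [mellin, Finset.smul_sum]
  rw [integral_finsetSum]
  · refine Finset.sum_congr rfl fun k hk => ?_
    have := mellin_inv_one_add_mul h0 h1 (neg_exp_mem_slitPlane hk)
    rw [neg_exp_cpow hk] at this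
    rw [mul_assoc ((star χ) (k : ZMod N)), ← this]
    exact mellin_const_smul _ s ((star χ) (k : ZMod N))
  · intro k hk
    exact (mellinConvergent_inv_one_add_mul h0 h1 (neg_exp_mem_slitPlane hk)).const_smul _

/-- The individual fractions have no Mellin transform on `Re s = 0`, but their combination is `O(t)`
at `0` and `O(1/t)` at infinity, so its transform is analytic for `-1 < Re s < 1`. The formula
follows by continuity from `s + ε`, `ε → 0⁺`; the point `s = 0` is excluded because `sin (π s)`
vanishes there. -/
theorem mellin_partialFractions {N : ℕ} (hN : 3 ≤ N) {χ : DirichletCharacter ℂ N}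
    (hχ : χ.IsPrimitive) {s : ℂ} (hs : s ≠ 0) (h0 : s.re = 0) :
    mellin (partialFractions χ) s = (gauss (star χ))⁻¹ * (∑ k ∈ Finset.Ico 1 N,
      (star χ) (k : ZMod N) * exp (((2 * Real.pi * k / N - Real.pi : ℝ) : ℂ) * I * -s))
        * (Real.pi / sin (Real.pi * s)) := by
  obtain ⟨C, hC, H⟩ := exists_norm_partialFractions_le hN hχ
  have hd : DifferentiableAt ℂ (mellin (partialFractions χ)) s := by
    refine mellin_differentiableAt_of_isBigO_rpow (a := 1) (b := -1)
      (((continuousOn_partialFractions χ).mono Ioi_subset_Ici_self).locallyIntegrableOn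
        measurableSet_Ioi) ?_ (by linarith) ?_ (by linarith)
    · refine Asymptotics.IsBigO.of_bound C ?_
      filter_upwards [eventually_gt_atTop 0] with t ht
      refine ((H t ht.le).1).trans ?_
      rw [Real.rpow_neg_one, norm_inv, Real.norm_of_nonneg ht.le]
      gcongr
      linarith
    · refine Asymptotics.IsBigO.of_bound C ?_
      filter_upwards [self_mem_nhdsWithin] with t ht
      have ht := mem_Ioi.1 ht
      simpa [Real.norm_of_nonneg ht.le, abs_of_pos ht] using (H t ht.le).2
  have hc : ContinuousAt (fun s : ℂ => (gauss (star χ))⁻¹ * (∑ k ∈ Finset.Ico 1 N,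
      (star χ) (k : ZMod N) * exp (((2 * Real.pi * k / N - Real.pi : ℝ) : ℂ) * I * -s))
        * (Real.pi / sin (Real.pi * s))) s := by
    refine ContinuousAt.mul (by fun_prop) (ContinuousAt.div (by fun_prop) (by fun_prop) ?_)
    exact sin_pi_mul_ne_zero hs (by linarith) (by linarith)
  have hlim : Tendsto (fun ε : ℝ => s + ε) (𝓝[>] 0) (𝓝 s) := by
    refine Tendsto.mono_left ?_ nhdsWithin_le_nhds
    have : Continuous fun ε : ℝ => s + ε := by fun_prop
    exact this.tendsto' 0 s (by simp)
  refine tendsto_nhds_unique (hd.continuousAt.tendsto.comp hlim)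
    ((hc.tendsto.comp hlim).congr' ?_)
  filter_upwards [Ioo_mem_nhdsGT (zero_lt_one' ℝ)] with ε hε
  exact (mellin_partialFractions_of_re_pos χ (by simp [h0, hε.1]) (by simp [h0, hε.2])).symm

end TwistedMordell

/-! ### Fourier transform of `Phi` and the functional equation. -/

namespace TwistedMordell

open Complex Set Filter Topology FourierTransform

theorem sqrt_natCast_pos {N : ℕ} (hN : 3 ≤ N) : 0 < Real.sqrt N :=
  Real.sqrt_pos.2 (by exact_mod_cast (by omega : 0 < N))

theorem Phi_eq_partialFractions {N : ℕ} (hN : 3 ≤ N) {χ : DirichletCharacter ℂ N}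
    (hχ : χ.IsPrimitive) {x : ℝ} (hx : x ≠ 0) :
    Phi χ x = partialFractions χ (Real.exp (2 * Real.pi / Real.sqrt N * x)) := by
  have hs := sqrt_natCast_pos hN
  have hne : 2 * Real.pi / Real.sqrt N * x ≠ 0 := by positivity
  rw [← phi_eq_partialFractions (by omega) hχ (Real.exp_pos _)
    (by rwa [Ne, Real.exp_eq_one_iff]), Phi]
  congr 1
  push_cast
  congr 1
  ring

/-- Only `x = 0` is left out, so the limiting value in the definition of `phi` never has to be
matched. -/
theorem Phi_ae_eq {N : ℕ} (hN : 3 ≤ N) {χ : DirichletCharacter ℂ N} (hχ : χ.IsPrimitive) :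
    Phi χ =ᵐ[volume] fun x => partialFractions χ (Real.exp (2 * Real.pi / Real.sqrt N * x)) := by
  filter_upwards [compl_mem_ae_iff.2 (measure_singleton (0:ℝ))] with x hx
  exact Phi_eq_partialFractions hN hχ hx

theorem continuous_partialFractions_exp {N : ℕ} (χ : DirichletCharacter ℂ N) (a : ℝ) :
    Continuous fun x : ℝ => partialFractions χ (Real.exp (a * x)) :=
  (continuousOn_partialFractions χ).comp_continuous (by fun_prop) fun x => (Real.exp_pos _).le

theorem integrable_partialFractions_exp {N : ℕ} (hN : 3 ≤ N) {χ : DirichletCharacter ℂ N}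
    (hχ : χ.IsPrimitive) {a : ℝ} (ha : 0 < a) :
    Integrable fun x : ℝ => partialFractions χ (Real.exp (a * x)) := by
  obtain ⟨C, hC, H⟩ := exists_norm_partialFractions_le hN hχ
  rw [← integrableOn_univ, ← Iic_union_Ioi (a := (0:ℝ))]
  refine IntegrableOn.union ?_ ?_
  · refine ((integrableOn_exp_mul_Iic ha 0).const_mul C).mono'
      (continuous_partialFractions_exp χ a).aestronglyMeasurable
      (Eventually.of_forall fun x => (H _ (Real.exp_pos _).le).2)
  · refine ((exp_neg_integrableOn_Ioi 0 ha).const_mul C).mono'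
      (continuous_partialFractions_exp χ a).aestronglyMeasurable
      (Eventually.of_forall fun x => (H _ (Real.exp_pos _).le).1.trans ?_)
    rw [neg_mul, Real.exp_neg]
    gcongr
    linarith

theorem integrable_Phi {N : ℕ} (hN : 3 ≤ N) {χ : DirichletCharacter ℂ N}
    (hχ : χ.IsPrimitive) : Integrable (Phi χ) := by
  have hs := sqrt_natCast_pos hN
  exact (integrable_partialFractions_exp hN hχ (by positivity)).congr (Phi_ae_eq hN hχ).symm

theorem integrable_gaussian {τ : ℂ} (hτ : 0 < τ.im) (z : ℂ) :
    Integrable fun x : ℝ => exp (Real.pi * I * τ * (x : ℂ) ^ 2 - 2 * Real.pi * z * x) := by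
  have hb : 0 < (-(Real.pi * I * τ)).re := by
    simp
    positivity
  refine (integrable_cexp_quadratic hb (-2 * Real.pi * z) 0).congr
    (Eventually.of_forall fun x => ?_)
  simp only
  congr 1
  ring

theorem integrable_integrand {N : ℕ} (hN : 3 ≤ N) {χ : DirichletCharacter ℂ N}
    (hχ : χ.IsPrimitive) {τ : ℂ} (hτ : 0 < τ.im) (z : ℂ) : Integrable (integrand χ z τ) := by
  obtain ⟨C, hC, H⟩ := exists_norm_partialFractions_le hN hχ
  refine (integrable_gaussian hτ z).bdd_mul (integrable_Phi hN hχ).aestronglyMeasurable (c := C) ?_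
  filter_upwards [Phi_ae_eq hN hχ] with x hx
  rw [hx]
  have h0 := Real.exp_pos (2 * Real.pi / Real.sqrt N * x)
  refine (H _ h0.le).1.trans (mul_le_of_le_one_right hC.le (inv_le_one_of_one_le₀ (by linarith)))

theorem fourier_Phi {N : ℕ} (hN : 3 ≤ N) {χ : DirichletCharacter ℂ N}
    (hχ : χ.IsPrimitive) {y : ℝ} (hy : y ≠ 0) :
    𝓕 (Phi χ) y = I * Real.sqrt N / gauss (star χ) * Phi (star χ) (-y) := by
  have hs := sqrt_natCast_pos hN
  have hsC : (Real.sqrt N : ℂ) ≠ 0 := by exact_mod_cast hs.ne'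
  have hpi : (Real.pi : ℂ) ≠ 0 := by exact_mod_cast Real.pi_ne_zero
  have hsq : (N : ℂ) = (Real.sqrt N : ℂ) * Real.sqrt N := by
    rw [← ofReal_mul, Real.mul_self_sqrt (Nat.cast_nonneg N), ofReal_natCast]
  set a := 2 * Real.pi / Real.sqrt N with ha_def
  have ha : 0 < a := by positivity
  have hη : Real.sqrt N * y ≠ 0 := mul_ne_zero hs.ne' hy
  -- The substitution `t = e^{a x}` gives `e^{-2πixy} = t^{-i√N y}` and `dx = dt / (a t)`. Since
  -- `mellin_eq_fourier` uses `t = e^{-u}`, the scaling factor is `-a`.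
  have h1 : 𝓕 (Phi χ) y = a⁻¹ * mellin (partialFractions χ) (-(Real.sqrt N * y : ℝ) * I) := by
    rw [mellin_eq_fourier, Real.fourier_real_eq_integral_exp_smul,
      Real.fourier_real_eq_integral_exp_smul]
    have := Measure.integral_comp_mul_left (fun u : ℝ => exp (((-2 * Real.pi * u *
      ((-((Real.sqrt N * y : ℝ) : ℂ) * I).im / (2 * Real.pi)) : ℝ) : ℂ) * I) •
      (Real.exp (-(-((Real.sqrt N * y : ℝ) : ℂ) * I).re * u) •
        partialFractions χ (Real.exp (-u)))) (-a)
    rw [abs_inv, abs_neg, abs_of_pos ha, real_smul] at this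
    rw [← this]
    refine integral_congr_ae ?_
    filter_upwards [Phi_ae_eq hN hχ] with x hx
    rw [hx]
    simp only [smul_eq_mul, real_smul]
    rw [neg_mul a x, neg_neg]
    simp only [mul_re, mul_im, neg_re, neg_im, ofReal_re, ofReal_im, I_re, I_im]
    simp only [mul_zero, mul_one, neg_zero, sub_self, zero_mul, Real.exp_zero, ofReal_one, one_mul,
      add_zero]
    congr 4
    rw [ha_def]
    field_simp
  set η : ℂ := ((Real.sqrt N * y : ℝ) : ℂ) with hη_def
  have hη0 : η ≠ 0 := by rw [hη_def]; exact_mod_cast hη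
  set E := exp (Real.pi * η) with hE
  have hE0 : E ≠ 0 := exp_ne_zero _
  have hE1 : E ^ 2 ≠ 1 := by
    rw [hE, ← exp_nat_mul, hη_def, ← ofReal_mul, ← ofReal_natCast, ← ofReal_mul, ← ofReal_exp,
      ← ofReal_one, Ne, ofReal_inj, Real.exp_eq_one_iff]
    have := Real.pi_ne_zero
    push_cast
    positivity
  set T := exp (2 * Real.pi * ((-y : ℝ) : ℂ) / Real.sqrt N) with hT
  have hT1 : T ≠ 1 := by
    have : T = ((Real.exp (2 * Real.pi * (-y) / Real.sqrt N) : ℝ) : ℂ) := by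
      rw [hT]
      push_cast
      rfl
    rw [this, ← ofReal_one, Ne, ofReal_inj, Real.exp_eq_one_iff]
    have := Real.pi_ne_zero
    have h2 : -y ≠ 0 := neg_ne_zero.2 hy
    positivity
  have hTN : T ^ N = (E ^ 2)⁻¹ := by
    rw [hT, hE, ← exp_nat_mul, ← exp_nat_mul, ← exp_neg, hη_def, hsq]
    congr 1
    push_cast
    field_simp
  -- The shift of the angles by `-π` produces the common factor `E`. It combines with `sin (π s)`, a
  -- multiple of `E - E⁻¹`, to the denominator `1 - T^N = 1 - E⁻²` of `phi`.
  have hsum : ∑ k ∈ Finset.Ico 1 N, (star χ) (k : ZMod N) *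
      exp (((2 * Real.pi * k / N - Real.pi : ℝ) : ℂ) * I * -(-η * I))
      = E * ∑ k ∈ Finset.Ico 1 N, (star χ) (k : ZMod N) * T ^ k := by
    rw [Finset.mul_sum]
    refine Finset.sum_congr rfl fun k _ => ?_
    rw [mul_left_comm]
    congr 1
    rw [hE, hT, ← exp_nat_mul, ← exp_add]
    congr 1
    rw [hη_def]
    push_cast
    rw [hsq]
    field_simp
    linear_combination (2 * k - (Real.sqrt N : ℂ) ^ 2) * y * I_sq
  have hsin : sin (Real.pi * (-η * I)) = -((E - E⁻¹) / 2 * I) := by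
    rw [show (Real.pi * (-η * I) : ℂ) = -((Real.pi * η) * I) by ring, sin_neg, sin_mul_I, sinh,
      exp_neg]
  rw [h1, mellin_partialFractions hN hχ (mul_ne_zero (neg_ne_zero.2 hη0) I_ne_zero)
      (by simp [hη_def]),
    hsum, hsin, Phi, ← hT, phi, if_neg hT1, hTN, ha_def]
  have hg := gauss_ne_zero (by omega : 1 < N) (star_isPrimitive hχ)
  have hE2 : E - E⁻¹ ≠ 0 := by
    intro h
    apply hE1
    field_simp at h
    linear_combination h
  have hE4 : (1 - (E ^ 2)⁻¹) * E = E - E⁻¹ := by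
    field_simp
  push_cast
  rw [← hE4]
  field_simp
  linear_combination (-∑ k ∈ Finset.Ico 1 N, (star χ) (k : ZMod N) * T ^ k) * I_sq

theorem h_neg_div {N : ℕ} (hN : 3 ≤ N) {χ : DirichletCharacter ℂ N}
    (hχ : χ.IsPrimitive) {τ : ℂ} (hτ : 0 < τ.im) (z : ℂ) :
    h χ (z / τ) (-1 / τ) = I * (Real.sqrt N : ℂ) / gauss (star χ)
      * exp (-(Real.pi * I * z ^ 2 / τ)) * (-I * τ) ^ (1 / 2 : ℂ) * h (star χ) (-z) τ := by
  have hτ0 : τ ≠ 0 := by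
    rintro rfl
    simp at hτ
  have hb : 0 < (-I * τ).re := by simpa using hτ
  have hb0 : (-I * τ) ^ (1 / 2 : ℂ) ≠ 0 := by
    rw [Ne, cpow_eq_zero_iff]
    exact fun hh => mul_ne_zero (neg_ne_zero.2 I_ne_zero) hτ0 hh.1
  -- Self-adjointness of the Fourier transform, with the Gaussian as second function.
  have hflip := VectorFourier.integral_fourierIntegral_smul_eq_flip (L := innerₗ ℝ)
    Real.continuous_fourierChar continuous_inner (integrable_Phi hN hχ) (integrable_gaussian hτ z)
  have hR : ∫ x : ℝ, Phi χ x • 𝓕 (fun x : ℝ =>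
      exp (Real.pi * I * τ * (x : ℂ) ^ 2 - 2 * Real.pi * z * x)) x
      = 1 / (-I * τ) ^ (1 / 2 : ℂ) * exp (Real.pi * I * z ^ 2 / τ) * h χ (z / τ) (-1 / τ) := by
    have hgauss : (fun x : ℝ => exp (Real.pi * I * τ * (x : ℂ) ^ 2 - 2 * Real.pi * z * x))
        = fun x : ℝ => exp (-Real.pi * (-I * τ) * x ^ 2 + 2 * Real.pi * (-z) * x) := by
      funext x
      congr 1
      ring
    rw [hgauss, fourier_gaussian_pi' hb, h, ← integral_const_mul]
    refine integral_congr_ae (Eventually.of_forall fun x => ?_)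
    simp only [integrand, smul_eq_mul]
    have : exp (-Real.pi / (-I * τ) * (x + I * -z) ^ 2) = exp (Real.pi * I * z ^ 2 / τ) *
        exp (Real.pi * I * (-1 / τ) * (x:ℂ) ^ 2 - 2 * Real.pi * (z / τ) * x) := by
      rw [← exp_add]
      congr 1
      field_simp
      linear_combination (x:ℂ) ^ 2 * I_sq
    rw [this]
    ring
  have hL : ∫ y : ℝ, 𝓕 (Phi χ) y • exp (Real.pi * I * τ * (y : ℂ) ^ 2 - 2 * Real.pi * z * y)
      = I * (Real.sqrt N : ℂ) / gauss (star χ) * h (star χ) (-z) τ := by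
    rw [h, ← integral_const_mul, ← integral_neg_eq_self]
    refine integral_congr_ae ?_
    filter_upwards [compl_mem_ae_iff.2 (measure_singleton (0:ℝ))] with y hy
    rw [fourier_Phi hN hχ (neg_ne_zero.2 hy), neg_neg, integrand, smul_eq_mul, mul_assoc]
    congr 3
    push_cast
    ring
  have hmain : ∫ y : ℝ, 𝓕 (Phi χ) y • exp (Real.pi * I * τ * (y : ℂ) ^ 2 - 2 * Real.pi * z * y)
      = ∫ x : ℝ, Phi χ x • 𝓕 (fun x : ℝ =>
        exp (Real.pi * I * τ * (x : ℂ) ^ 2 - 2 * Real.pi * z * x)) x := by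
    simpa using! hflip
  rw [hL, hR] at hmain
  rw [mul_assoc, mul_assoc, exp_neg]
  have := exp_ne_zero (Real.pi * I * z ^ 2 / τ)
  rw [mul_left_comm, mul_left_comm (I * _ / _), hmain]
  field_simp

end TwistedMordell

/-! ### Theta functions at cusps and the Landsberg–Schaar identity. -/

open Complex Filter Topology in
theorem ofReal_mul_cpow {a : ℝ} (ha : 0 < a) {z : ℂ} (hz : z ≠ 0) (s : ℂ) :
    ((a : ℂ) * z) ^ s = (a : ℂ) ^ s * z ^ s := by
  have ha' : (a : ℂ) ≠ 0 := by exact_mod_cast ha.ne'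
  rw [cpow_def_of_ne_zero (mul_ne_zero ha' hz), cpow_def_of_ne_zero ha', cpow_def_of_ne_zero hz,
    log_ofReal_mul ha hz, add_mul, exp_add, ofReal_log ha.le]

open Complex Filter Topology in
theorem tendsto_jacobiTheta₂_of_im_atTop {α : Type*} {l : Filter α} (x : ℝ) {w : α → ℂ}
    (hw : Tendsto (fun i => (w i).im) l atTop) :
    Tendsto (fun i => jacobiTheta₂ x (w i)) l (𝓝 1) := by
  have hlim : ∀ n : ℤ, Tendsto (fun i => jacobiTheta₂_term n x (w i)) l
      (𝓝 (if n = 0 then 1 else 0)) := by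
    intro n
    split_ifs with hn
    · simpa [hn, jacobiTheta₂_term] using tendsto_const_nhds
    · rw [tendsto_zero_iff_norm_tendsto_zero]
      simp_rw [norm_jacobiTheta₂_term]
      refine Real.tendsto_exp_atBot.comp ?_
      simp only [ofReal_im, mul_zero, sub_zero]
      refine hw.const_mul_atTop_of_neg ?_
      have : (0:ℝ) < (n:ℝ) ^ 2 := by positivity
      nlinarith [Real.pi_pos]
  have hbound := summable_pow_mul_jacobiTheta₂_term_bound 0 one_pos 0
  simp only [pow_zero, one_mul] at hbound
  have := tendsto_tsum_of_dominated_convergence hbound hlim (by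
    filter_upwards [hw.eventually_ge_atTop 1] with i hi n
    simpa using norm_jacobiTheta₂_term_le (S := 0) one_pos (z := (x:ℂ)) (by simp) hi n)
  simpa [jacobiTheta₂] using this

theorem tsum_int_eq_sum_range {E : Type*} [NormedAddCommGroup E] [CompleteSpace E] {f : ℤ → E}
    (hf : Summable f) (M : ℕ) [NeZero M] :
    ∑' n, f n = ∑ r ∈ Finset.range M, ∑' m : ℤ, f (m * M + r) := by
  let e : Fin M × ℤ ≃ ℤ := (Equiv.prodComm _ _).trans (Int.divModEquiv M).symm
  have hs : Summable fun x : Fin M × ℤ => f (e x) := e.summable_iff.2 hf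
  rw [← e.tsum_eq f, hs.tsum_prod, tsum_fintype, Finset.sum_range]
  rfl

-- The sum over one residue class modulo `M` is a two-variable theta function at `M² w`. In its
-- functional equation the Gaussian prefactor cancels exactly, leaving a form whose limit at the
-- cusp is immediate.
open Complex Filter Topology in
theorem tsum_exp_progression {M : ℕ} (hM : 0 < M) (r : ℕ) {w : ℂ} (hw : 0 < w.im) :
    (-I * w) ^ (1 / 2 : ℂ) * ∑' m : ℤ, exp (Real.pi * I * ((m * M + r : ℤ) : ℂ) ^ 2 * w)
      = (M : ℂ)⁻¹ * jacobiTheta₂ ((r / M : ℝ) : ℂ) (-1 / ((M : ℂ) ^ 2 * w)) := by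
  have hw0 : w ≠ 0 := by
    rintro rfl
    simp at hw
  have hM0 : (M : ℂ) ≠ 0 := by exact_mod_cast hM.ne'
  have hIw : -I * w ≠ 0 := mul_ne_zero (neg_ne_zero.2 I_ne_zero) hw0
  have h1 : ∑' m : ℤ, exp (Real.pi * I * ((m * M + r : ℤ) : ℂ) ^ 2 * w)
      = exp (Real.pi * I * r ^ 2 * w) * jacobiTheta₂ (M * r * w) ((M : ℂ) ^ 2 * w) := by
    rw [jacobiTheta₂, ← tsum_mul_left]
    refine tsum_congr fun m => ?_
    rw [jacobiTheta₂_term, ← exp_add]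
    congr 1
    push_cast
    ring
  have h2 : (-I * ((M : ℂ) ^ 2 * w)) ^ (1 / 2 : ℂ) = M * (-I * w) ^ (1 / 2 : ℂ) := by
    rw [show -I * ((M : ℂ) ^ 2 * w) = (((M : ℝ) ^ 2 : ℝ) : ℂ) * (-I * w) by push_cast; ring,
      ofReal_mul_cpow (by positivity) hIw]
    congr 1
    rw [show (1 / 2 : ℂ) = ((1 / 2 : ℝ) : ℂ) by push_cast; rfl, ← ofReal_cpow (by positivity),
      ← Real.sqrt_eq_rpow, Real.sqrt_sq (by positivity), ofReal_natCast]
  have h3 : (-I * w) ^ (1 / 2 : ℂ) ≠ 0 := by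
    rw [Ne, cpow_eq_zero_iff]
    exact fun h => hIw h.1
  have h4 : exp (Real.pi * I * r ^ 2 * w) *
      exp (-Real.pi * I * (M * r * w) ^ 2 / ((M : ℂ) ^ 2 * w)) = 1 := by
    rw [← exp_add, exp_eq_one_iff]
    refine ⟨0, ?_⟩
    field_simp
    simp
  rw [h1, jacobiTheta₂_functional_equation, h2]
  have h5 : (M * r * w : ℂ) / ((M : ℂ) ^ 2 * w) = ((r / M : ℝ) : ℂ) := by
    push_cast
    field_simp
  rw [h5]
  calc _ = (exp (Real.pi * I * r ^ 2 * w) *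
      exp (-Real.pi * I * (M * r * w) ^ 2 / ((M : ℂ) ^ 2 * w))) *
      ((M : ℂ)⁻¹ * jacobiTheta₂ ((r / M : ℝ) : ℂ) (-1 / ((M : ℂ) ^ 2 * w))) := by
        field_simp
    _ = _ := by rw [h4, one_mul]

open Complex Filter Topology in
/-- The behaviour of the theta function at a cusp `a`, in terms of a quadratic Gauss sum. -/
theorem tendsto_jacobiTheta_cusp {α : Type*} {l : Filter α} {w : α → ℂ} (hw0 : ∀ i, 0 < (w i).im)
    (hw : Tendsto (fun i => (-1 / w i).im) l atTop) {M : ℕ} (hM : 0 < M) {a : ℝ}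
    (ha : ∀ (m : ℤ) (r : ℕ), exp (Real.pi * I * ((m * M + r : ℤ) : ℂ) ^ 2 * a)
      = exp (Real.pi * I * (r : ℂ) ^ 2 * a)) :
    Tendsto (fun i => (-I * w i) ^ (1 / 2 : ℂ) * jacobiTheta (a + w i)) l
      (𝓝 ((M : ℂ)⁻¹ * ∑ r ∈ Finset.range M, exp (Real.pi * I * (r : ℂ) ^ 2 * a))) := by
  have : NeZero M := ⟨hM.ne'⟩
  have h1 : ∀ i, (-I * w i) ^ (1 / 2 : ℂ) * jacobiTheta (a + w i)
      = ∑ r ∈ Finset.range M, exp (Real.pi * I * (r : ℂ) ^ 2 * a) *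
        ((M : ℂ)⁻¹ * jacobiTheta₂ ((r / M : ℝ) : ℂ) (-1 / ((M : ℂ) ^ 2 * w i))) := by
    intro i
    have hs : Summable fun n : ℤ => exp (Real.pi * I * (n : ℂ) ^ 2 * (a + w i)) := by
      have := (summable_jacobiTheta₂_term_iff 0 (a + w i)).2 (by simpa using hw0 i)
      simpa [jacobiTheta₂_term] using this
    rw [jacobiTheta, tsum_int_eq_sum_range hs M, Finset.mul_sum]
    refine Finset.sum_congr rfl fun r _ => ?_
    have h : ∑' m : ℤ, exp (Real.pi * I * ((m * M + r : ℤ) : ℂ) ^ 2 * (a + w i))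
        = exp (Real.pi * I * (r : ℂ) ^ 2 * a) *
          ∑' m : ℤ, exp (Real.pi * I * ((m * M + r : ℤ) : ℂ) ^ 2 * w i) := by
      rw [← tsum_mul_left]
      exact tsum_congr fun m => by rw [mul_add, exp_add, ha]
    rw [← tsum_exp_progression hM r (hw0 i), h]
    ring
  simp_rw [h1, Finset.mul_sum]
  refine tendsto_finsetSum (Finset.range M) fun r _ => ?_
  have h2 : Tendsto (fun i => (-1 / ((M : ℂ) ^ 2 * w i)).im) l atTop := by
    have hM2 : (0:ℝ) < ((M:ℝ) ^ 2)⁻¹ := by positivity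
    refine (hw.const_mul_atTop hM2).congr fun i => ?_
    rw [← im_ofReal_mul]
    congr 1
    push_cast
    rw [div_mul_eq_div_div_swap, div_eq_inv_mul _ ((M:ℂ) ^ 2)]
  have := ((tendsto_jacobiTheta₂_of_im_atTop (r / M : ℝ) h2).const_mul (M : ℂ)⁻¹).const_mul
    (exp (Real.pi * I * (r : ℂ) ^ 2 * a))
  simpa [mul_comm] using this

open Complex Filter Topology in
/-- A form of the Landsberg–Schaar identity. -/
theorem landsberg_schaar {N p : ℕ} (hN : 0 < N) (hp : 0 < p) :
    ∑ n ∈ Finset.range N, exp (2 * Real.pi * I * p * n ^ 2 / N)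
      = ((-I) ^ (1 / 2 : ℂ))⁻¹ * (Real.sqrt (N / (2 * p)) : ℂ) *
        ∑ n ∈ Finset.range (2 * p), exp (-(Real.pi * I * N * n ^ 2 / (2 * p))) := by
  have hN0 : (N : ℂ) ≠ 0 := by exact_mod_cast hN.ne'
  have hp0 : (p : ℂ) ≠ 0 := by exact_mod_cast hp.ne'
  have hNR : (0:ℝ) < N := by exact_mod_cast hN
  have hpR : (0:ℝ) < p := by exact_mod_cast hp
  set a : ℝ := 2 * p / N with ha_def
  have ha : 0 < a := by positivity
  have haC : (a : ℂ) ≠ 0 := by exact_mod_cast ha.ne'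
  have ha' : a⁻¹ = N / (2 * p) := by rw [ha_def, inv_div]
  let ε : ℕ → ℝ := fun n => 1 / ((n : ℝ) + 1)
  have hε : ∀ n, 0 < ε n := fun n => by positivity
  have hε0 : Tendsto ε atTop (𝓝 0) := tendsto_one_div_add_atTop_nhds_zero_nat
  have hεinv : Tendsto (fun n => (ε n)⁻¹) atTop atTop :=
    tendsto_inv_nhdsGT_zero.comp
      (tendsto_nhdsWithin_iff.2 ⟨hε0, Eventually.of_forall hε⟩)
  let τ : ℕ → ℂ := fun n => a + I * ε n
  have hτre : ∀ n, (τ n).re = a := fun n => by simp [τ]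
  have hτ0 : ∀ n, τ n ≠ 0 := fun n h => by
    have := hτre n
    rw [h, zero_re] at this
    exact ha.ne this
  have hεC : ∀ n, (ε n : ℂ) ≠ 0 := fun n => by exact_mod_cast (hε n).ne'
  have hτlim : Tendsto τ atTop (𝓝 a) := by
    have : Continuous fun x : ℝ => (a : ℂ) + I * x := by fun_prop
    exact (this.tendsto' 0 (a:ℂ) (by simp)).comp hε0
  -- Chosen so that `-1 / τ n = -a⁻¹ + w n`: as `τ n` tends to the cusp `a`, its image under `τ ↦
  -- -1/τ` tends to the cusp `-a⁻¹`.
  let w : ℕ → ℂ := fun n => ((a⁻¹ * ε n : ℝ) : ℂ) * (I * (τ n)⁻¹)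
  have hwinv : ∀ n, (-1 / w n).im = a ^ 2 * (ε n)⁻¹ := by
    intro n
    have h : -1 / w n = ((a * (ε n)⁻¹ : ℝ) : ℂ) * (I * τ n) := by
      simp only [w]
      push_cast
      have := hτ0 n
      have := hεC n
      field_simp
      linear_combination -I_sq
    rw [h, im_ofReal_mul, I_mul_im, hτre]
    ring
  have hwpos : ∀ n, 0 < (w n).im := by
    intro n
    simp only [w]
    rw [im_ofReal_mul, I_mul_im, inv_re, hτre]
    have := normSq_pos.2 (hτ0 n)
    have := hε n
    positivity
  -- At `a = 2p/N` the phase has period `N`; at `-a⁻¹ = -N/(2p)` it has period `2p`. The identity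
  -- compares the two limits through the functional equation of theta.
  have h1 := tendsto_jacobiTheta_cusp (w := fun n => I * (ε n : ℂ)) (l := atTop) (a := a) (M := N)
    (fun n => by simpa using hε n) (by
      refine hεinv.congr fun n => ?_
      have : -1 / (I * (ε n : ℂ)) = (((ε n)⁻¹ : ℝ) : ℂ) * I := by
        have := hεC n
        push_cast
        field_simp
        linear_combination -I_sq
      rw [this, im_ofReal_mul, I_im, mul_one]) hN (by
      intro m r
      rw [exp_eq_exp_iff_exists_int]
      refine ⟨m ^ 2 * N * p + 2 * m * r * p, ?_⟩
      rw [ha_def]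
      push_cast
      field_simp
      ring)
  have h2 := tendsto_jacobiTheta_cusp (w := w) (l := atTop) (a := -a⁻¹) (M := 2 * p)
    hwpos (by
      simp_rw [hwinv]
      exact hεinv.const_mul_atTop (by positivity)) (by positivity) (by
      intro m r
      rw [exp_eq_exp_iff_exists_int]
      refine ⟨-(m ^ 2 * N * p + m * r * N), ?_⟩
      rw [ha']
      push_cast
      field_simp
      ring)
  have hθ : ∀ n, (-I * (I * (ε n : ℂ))) ^ (1 / 2 : ℂ) * jacobiTheta (a + I * (ε n : ℂ))
      = ((-I * τ n) ^ (1 / 2 : ℂ) * ((a⁻¹ : ℝ) : ℂ) ^ (1 / 2 : ℂ) * (τ n)⁻¹ ^ (1 / 2 : ℂ))⁻¹ *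
        ((-I * w n) ^ (1 / 2 : ℂ) * jacobiTheta (((-a⁻¹ : ℝ) : ℂ) + w n)) := by
    intro n
    have e1 : -I * (I * (ε n : ℂ)) = (ε n : ℂ) := by linear_combination (-(ε n : ℂ)) * I_sq
    have e2 : -I * w n = ((ε n : ℝ) : ℂ) * (((a⁻¹ : ℝ) : ℂ) * (τ n)⁻¹) := by
      simp only [w]
      push_cast
      linear_combination (-(a:ℂ)⁻¹ * ε n * (τ n)⁻¹) * I_sq
    have e3 : ((-a⁻¹ : ℝ) : ℂ) + w n = -1 / τ n := by
      have := hτ0 n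
      simp only [w]
      push_cast
      field_simp
      simp only [τ]
      ring
    have hne : ∀ z : ℂ, z ≠ 0 → z ^ (1 / 2 : ℂ) ≠ 0 := by
      intro z hz
      rw [Ne, cpow_eq_zero_iff]
      exact fun h => hz h.1
    have hainv : ((a⁻¹ : ℝ) : ℂ) ≠ 0 := by exact_mod_cast (inv_pos.2 ha).ne'
    rw [e1, e2, e3, ofReal_mul_cpow (hε n) (mul_ne_zero hainv (inv_ne_zero (hτ0 n))),
      ofReal_mul_cpow (inv_pos.2 ha) (inv_ne_zero (hτ0 n)), jacobiTheta_eq_jacobiTheta₂,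
      jacobiTheta_eq_jacobiTheta₂]
    have := jacobiTheta₂_functional_equation 0 (τ n)
    simp only [τ] at this ⊢
    rw [this]
    have n1 := hne _ hainv
    have n2 := hne _ (inv_ne_zero (hτ0 n))
    have n3 := hne _ (mul_ne_zero (neg_ne_zero.2 I_ne_zero) (hτ0 n))
    simp only [τ] at n2 n3
    simp only [ne_eq, OfNat.ofNat_ne_zero, not_false_eq_true, zero_pow, mul_zero, zero_div, exp_zero,
      mul_one]
    generalize (-I * (a + I * (ε n : ℂ))) ^ (1 / 2 : ℂ) = x at *
    generalize ((a⁻¹ : ℝ) : ℂ) ^ (1 / 2 : ℂ) = y at *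
    generalize (a + I * (ε n : ℂ))⁻¹ ^ (1 / 2 : ℂ) = v at *
    field_simp
  simp_rw [hθ] at h1
  have h3 : Tendsto (fun n => ((-I * τ n) ^ (1 / 2 : ℂ) * ((a⁻¹ : ℝ) : ℂ) ^ (1 / 2 : ℂ) *
      (τ n)⁻¹ ^ (1 / 2 : ℂ))⁻¹) atTop (𝓝 (((-I * a) ^ (1 / 2 : ℂ) * ((a⁻¹ : ℝ) : ℂ) ^ (1 / 2 : ℂ) *
      ((a⁻¹ : ℝ) : ℂ) ^ (1 / 2 : ℂ))⁻¹)) := by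
    have hslit : -I * (a : ℂ) ∈ slitPlane := by
      rw [mem_slitPlane_iff]
      right
      simpa using ha.ne'
    have hinv : Tendsto (fun n => (τ n)⁻¹) atTop (𝓝 ((a⁻¹ : ℝ) : ℂ)) := by
      rw [ofReal_inv]
      exact hτlim.inv₀ haC
    refine Tendsto.inv₀ (Tendsto.mul (Tendsto.mul_const _ ?_) ?_) ?_
    · exact (hτlim.const_mul (-I)).cpow tendsto_const_nhds hslit
    · exact hinv.cpow tendsto_const_nhds (ofReal_mem_slitPlane.2 (inv_pos.2 ha))
    · have hainv : ((a⁻¹ : ℝ) : ℂ) ≠ 0 := by exact_mod_cast (inv_pos.2 ha).ne'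
      refine mul_ne_zero (mul_ne_zero ?_ ?_) ?_ <;> rw [Ne, cpow_eq_zero_iff]
      · exact fun h => slitPlane_ne_zero hslit h.1
      · exact fun h => hainv h.1
      · exact fun h => hainv h.1
  have h4 := tendsto_nhds_unique h1 (h3.mul h2)
  have h5 : ((a⁻¹ : ℝ) : ℂ) ^ (1 / 2 : ℂ) = (Real.sqrt (N / (2 * p)) : ℂ) := by
    rw [show (1 / 2 : ℂ) = ((1 / 2 : ℝ) : ℂ) by push_cast; rfl, ← ofReal_cpow (by positivity),
      ← Real.sqrt_eq_rpow, ha']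
  have h6 : (-I * a) ^ (1 / 2 : ℂ) = (Real.sqrt (N / (2 * p)) : ℂ)⁻¹ * (-I) ^ (1 / 2 : ℂ) := by
    rw [mul_comm, ofReal_mul_cpow ha (neg_ne_zero.2 I_ne_zero),
      show (1 / 2 : ℂ) = ((1 / 2 : ℝ) : ℂ) by push_cast; rfl, ← ofReal_cpow (by positivity),
      ← Real.sqrt_eq_rpow, ← ha', Real.sqrt_inv]
    simp
  rw [h5, h6] at h4
  have e1 : ∑ n ∈ Finset.range N, exp (2 * Real.pi * I * p * n ^ 2 / N)
      = ∑ r ∈ Finset.range N, exp (Real.pi * I * (r : ℂ) ^ 2 * a) := by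
    refine Finset.sum_congr rfl fun n _ => ?_
    rw [ha_def]
    push_cast
    congr 1
    ring
  have e2 : ∑ n ∈ Finset.range (2 * p), exp (-(Real.pi * I * N * n ^ 2 / (2 * p)))
      = ∑ r ∈ Finset.range (2 * p), exp (Real.pi * I * (r : ℂ) ^ 2 * ((-a⁻¹ : ℝ) : ℂ)) := by
    refine Finset.sum_congr rfl fun n _ => ?_
    rw [ha']
    push_cast
    congr 1
    ring
  have hsq : (Real.sqrt (N / (2 * p)) : ℂ) * (Real.sqrt (N / (2 * p)) : ℂ) = N / (2 * p) := by
    rw [← ofReal_mul, Real.mul_self_sqrt (by positivity)]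
    push_cast
    rfl
  have hs0 : (Real.sqrt (N / (2 * p)) : ℂ) ≠ 0 := by
    have : 0 < Real.sqrt (N / (2 * p)) := Real.sqrt_pos.2 (by positivity)
    exact_mod_cast this.ne'
  rw [e1, e2]
  rw [inv_mul_eq_iff_eq_mul₀ hN0] at h4
  rw [h4]
  have hI : (-I) ^ (1 / 2 : ℂ) ≠ 0 := by
    rw [Ne, cpow_eq_zero_iff]
    exact fun h => neg_ne_zero.2 I_ne_zero h.1
  push_cast
  set S := ∑ r ∈ Finset.range (2 * p), exp (Real.pi * I * (r : ℂ) ^ 2 * -(a:ℂ)⁻¹)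
  set q := (Real.sqrt (N / (2 * p)) : ℂ)
  have hNq : (N : ℂ) = q * q * (2 * p) := by rw [hsq]; field_simp
  rw [hNq]
  field_simp

/-! ### Quadratic Gauss sums modulo `N` twisted by an odd prime. -/

theorem sum_range_two_mul {M : Type*} [AddCommMonoid M] (f : ℕ → M) (n : ℕ) :
    ∑ i ∈ Finset.range (2 * n), f i
      = ∑ i ∈ Finset.range n, f (2 * i) + ∑ i ∈ Finset.range n, f (2 * i + 1) := by
  induction n with
  | zero => simp
  | succ n ih =>
    rw [mul_add, mul_one, Finset.sum_range_succ, Finset.sum_range_succ, ih, Finset.sum_range_succ,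
      Finset.sum_range_succ]
    abel

open Complex in
theorem landsberg_schaar_zmod {N p : ℕ} [NeZero N] [NeZero p] (hp : Odd p) :
    ∑ x : ZMod N, ZMod.stdAddChar ((p : ZMod N) * x ^ 2)
      = ((-I) ^ (1 / 2 : ℂ))⁻¹ * (Real.sqrt (N / (2 * p)) : ℂ) *
        ((1 + exp (-(Real.pi * I * p / 2)) ^ N) *
          ∑ x : ZMod p, ZMod.stdAddChar (-(N : ZMod p) * x ^ 2)) := by
  have hp0 : (p : ℂ) ≠ 0 := NeZero.ne _
  have h1 : ∑ x : ZMod N, ZMod.stdAddChar ((p : ZMod N) * x ^ 2)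
      = ∑ n ∈ Finset.range N, exp (2 * Real.pi * I * p * n ^ 2 / N) := by
    rw [← ZMod.sum_range_natCast]
    refine Finset.sum_congr rfl fun n _ => ?_
    have := ZMod.stdAddChar_coe (N := N) (p * n ^ 2)
    push_cast at this
    rw [this]
    congr 1
    ring
  have hstd : ∀ u : ℤ, ZMod.stdAddChar (-(N : ZMod p) * (u : ZMod p) ^ 2)
      = exp (-(2 * Real.pi * I * N * u ^ 2 / p)) := by
    intro u
    have := ZMod.stdAddChar_coe (N := p) (-N * u ^ 2)
    push_cast at this
    rw [this]
    congr 1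
    ring
  obtain ⟨k, hk⟩ := hp
  have heven : ∀ y : ℕ, exp (-(Real.pi * I * N * ((2 * y : ℕ) : ℂ) ^ 2 / (2 * p)))
      = ZMod.stdAddChar (-(N : ZMod p) * (y : ZMod p) ^ 2) := by
    intro y
    have := hstd y
    push_cast at this ⊢
    rw [this]
    congr 1
    ring
  -- With `p = 2k + 1`, the odd number `2y + 1` is `2(y - k) + p`. On squaring, the cross term
  -- contributes an integer multiple of `2πi`, and `p²` gives the constant factor.
  have hodd : ∀ y : ℕ, exp (-(Real.pi * I * N * ((2 * y + 1 : ℕ) : ℂ) ^ 2 / (2 * p)))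
      = exp (-(Real.pi * I * p / 2)) ^ N *
        ZMod.stdAddChar (-(N : ZMod p) * ((y : ZMod p) - (k : ZMod p)) ^ 2) := by
    intro y
    have := hstd (y - k)
    push_cast at this ⊢
    rw [this, ← exp_nat_mul, ← exp_add, exp_eq_exp_iff_exists_int]
    refine ⟨-(N * (y - k)), ?_⟩
    have hkC : (p : ℂ) = 2 * k + 1 := by exact_mod_cast hk
    have hy : (2 * y + 1 : ℂ) = 2 * (y - k) + p := by rw [hkC]; ring
    rw [hy]
    push_cast
    field_simp
    ring
  have hshift : ∑ y : ZMod p, (ZMod.stdAddChar (-(N : ZMod p) * (y - (k : ZMod p)) ^ 2) : ℂ)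
      = ∑ y : ZMod p, ZMod.stdAddChar (-(N : ZMod p) * y ^ 2) :=
    Fintype.sum_equiv (Equiv.subRight (k : ZMod p)) _ _ fun _ => rfl
  rw [h1, landsberg_schaar (NeZero.pos N) (NeZero.pos p), sum_range_two_mul]
  simp_rw [heven, hodd]
  rw [ZMod.sum_range_natCast (fun y : ZMod p => ZMod.stdAddChar (-(N : ZMod p) * y ^ 2)),
    ← Finset.mul_sum,
    ZMod.sum_range_natCast
      (fun y : ZMod p => ZMod.stdAddChar (-(N : ZMod p) * (y - (k : ZMod p)) ^ 2)),
    hshift]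
  ring

/-- A residue `b` has `1 + quadraticChar b` square roots and the full sum of `ψ` vanishes, so these
are Gauss sums of the quadratic character, which scale by its value at `a`. -/
theorem sum_addChar_mul_sq {p : ℕ} [Fact p.Prime] (hp : p ≠ 2) {ψ : AddChar (ZMod p) ℂ}
    (hψ : ψ.IsPrimitive) {a : ZMod p} (ha : a ≠ 0) :
    ∑ x : ZMod p, ψ (a * x ^ 2)
      = (quadraticChar (ZMod p) a : ℂ) * ∑ x : ZMod p, ψ (x ^ 2) := by
  have key : ∀ a : ZMod p, a ≠ 0 → ∑ x : ZMod p, ψ (a * x ^ 2)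
      = gaussSum ((quadraticChar (ZMod p)).ringHomComp (Int.castRingHom ℂ)) (ψ.mulShift a) := by
    intro a ha
    have h1 : ∑ x : ZMod p, ψ (a * x ^ 2)
        = ∑ b : ZMod p, ((quadraticChar (ZMod p) b + 1 : ℤ) : ℂ) * ψ (a * b) := by
      rw [← Finset.sum_fiberwise (s := Finset.univ) (g := fun x : ZMod p => x ^ 2)]
      refine Finset.sum_congr rfl fun b _ => ?_
      rw [← quadraticChar_card_sqrts (by rwa [ZMod.ringChar_zmod_n]) b]
      rw [Finset.sum_congr rfl (g := fun _ => ψ (a * b)) (by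
        intro x hx
        rw [(Finset.mem_filter.1 hx).2]), Finset.sum_const, nsmul_eq_mul]
      congr 2
      simp
    have h2 : ∑ b : ZMod p, ψ (a * b) = 0 := AddChar.sum_eq_zero_of_ne_one (hψ ha)
    rw [h1, gaussSum]
    simp only [Int.cast_add, Int.cast_one, add_mul, one_mul, Finset.sum_add_distrib, h2, add_zero]
    rfl
  have h3 := gaussSum_mulShift_eq ((quadraticChar (ZMod p)).ringHomComp (Int.castRingHom ℂ)) ψ
    (Units.mk0 a ha)
  have h4 := key 1 one_ne_zero
  simp only [one_mul, AddChar.mulShift_one] at h4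
  rw [key a ha, h4]
  have h5 : (((quadraticChar (ZMod p)).ringHomComp (Int.castRingHom ℂ))⁻¹ : MulChar (ZMod p) ℂ)
      = (quadraticChar (ZMod p)).ringHomComp (Int.castRingHom ℂ) :=
    ((quadraticChar_isQuadratic (ZMod p)).comp _).inv
  rw [h5] at h3
  exact h3

open Complex in
theorem quadratic_gaussSum_prime_shift {N p : ℕ} [NeZero N] [Fact p.Prime] (hp : p ≠ 2)
    (hpN : ¬ p ∣ N) :
    (jacobiSym (-N) p : ℂ) * ∑ x : ZMod N, ZMod.stdAddChar ((p : ZMod N) * x ^ 2)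
      = I * (Real.sqrt N / 2 : ℝ) *
        ((1 + exp (-(Real.pi * I * p / 2)) ^ N) * (1 + exp (-(Real.pi * I * p / 2)))) := by
  have hpo : Odd p := (Fact.out : p.Prime).odd_of_ne_two hp
  have hpN' : -(N : ZMod p) ≠ 0 := by
    rwa [neg_ne_zero, Ne, ZMod.natCast_eq_zero_iff]
  have h1 := landsberg_schaar_zmod (N := N) hpo
  -- With `1` in the role of the prime, the identity evaluates the Gauss sum modulo `p` itself.
  have h2 := landsberg_schaar_zmod (N := p) (p := 1) odd_one
  have h3 := sum_addChar_mul_sq hp (ZMod.isPrimitive_stdAddChar p) hpN'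
  have hJ : jacobiSym (-N) p = quadraticChar (ZMod p) (-(N : ZMod p)) := by
    rw [← jacobiSym.legendreSym.to_jacobiSym, legendreSym]
    push_cast
    rfl
  have hJ2 : (jacobiSym (-N) p : ℂ) * (jacobiSym (-N) p : ℂ) = 1 := by
    have := quadraticChar_sq_one hpN'
    rw [← hJ, sq] at this
    exact_mod_cast this
  rw [← hJ] at h3
  have h4 : ∑ x : ZMod p, ZMod.stdAddChar (x ^ 2) = ((-I) ^ (1 / 2 : ℂ))⁻¹ *
      (Real.sqrt (p / 2) : ℂ) * (1 + exp (-(Real.pi * I * p / 2))) := by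
    simp only [Nat.cast_one, one_mul, mul_one] at h2
    rw [h2, ← exp_nat_mul]
    have h5 : ∑ x : ZMod 1, ZMod.stdAddChar (-(p : ZMod 1) * x ^ 2) = (1 : ℂ) := by
      rw [Fintype.sum_unique, Subsingleton.elim (-(p : ZMod 1) * _) 0, AddChar.map_zero_eq_one]
    rw [h5, mul_one]
    congr 3
    ring
  have hκ : ((-I) ^ (1 / 2 : ℂ))⁻¹ * ((-I) ^ (1 / 2 : ℂ))⁻¹ = I := by
    rw [← mul_inv, ← cpow_add _ _ (neg_ne_zero.2 I_ne_zero), add_halves, cpow_one, inv_neg, inv_I,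
      neg_neg]
  have hsq : (Real.sqrt (N / (2 * p)) : ℂ) * (Real.sqrt (p / 2) : ℂ) = (Real.sqrt N / 2 : ℝ) := by
    rw [← ofReal_mul, ← Real.sqrt_mul (by positivity)]
    congr 1
    have hp0 : (p : ℝ) ≠ 0 := by exact_mod_cast (Fact.out : p.Prime).ne_zero
    rw [show (N : ℝ) / (2 * p) * (p / 2) = N / 2 ^ 2 by field_simp,
      Real.sqrt_div (by positivity), Real.sqrt_sq (by norm_num)]
  rw [h1, h3, h4, ← hsq]
  generalize ((-I) ^ (1 / 2 : ℂ))⁻¹ = κ at *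
  generalize (jacobiSym (-N) p : ℂ) = j at *
  generalize exp (-(Real.pi * I * p / 2)) = u at *
  rw [← hκ]
  linear_combination (κ * κ * (Real.sqrt (N / (2 * p)) : ℂ) * (Real.sqrt (p / 2) : ℂ) *
    (1 + u ^ N) * (1 + u)) * hJ2

-- The product is `2(1 + u)`, `2u`, `0` or `2` according to `N` modulo `4`.
open Complex in
theorem re_one_add_pow_mul_nonneg {u : ℂ} (hu : u = I ∨ u = -I) (N : ℕ) :
    0 ≤ ((1 + u ^ N) * (1 + u)).re := by
  have h4 : u ^ 4 = 1 := by
    rcases hu with rfl | rfl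
    · exact I_pow_four
    · rw [Even.neg_pow (by decide), I_pow_four]
  rw [← Nat.mod_add_div N 4, pow_add, pow_mul, h4, one_pow, mul_one]
  have : N % 4 < 4 := Nat.mod_lt _ (by norm_num)
  interval_cases N % 4 <;> rcases hu with rfl | rfl <;> simp [pow_succ]

open Complex in
theorem im_jacobiSym_mul_nonneg {N p : ℕ} [NeZero N] [Fact p.Prime] (hp : p ≠ 2)
    (hpN : ¬ p ∣ N) :
    0 ≤ ((jacobiSym (-N) p : ℂ) * ∑ x : ZMod N, ZMod.stdAddChar ((p : ZMod N) * x ^ 2)).im := by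
  have hu : exp (-(Real.pi * I * p / 2)) = I ∨ exp (-(Real.pi * I * p / 2)) = -I := by
    have h2 : exp (-(Real.pi * I * p / 2)) ^ 2 = I ^ 2 := by
      obtain ⟨k, hk⟩ := (Fact.out : p.Prime).odd_of_ne_two hp
      rw [← exp_nat_mul, I_sq, ← exp_pi_mul_I, exp_eq_exp_iff_exists_int]
      refine ⟨-(k + 1), ?_⟩
      rw [hk]
      push_cast
      ring
    exact sq_eq_sq_iff_eq_or_eq_neg.1 h2
  rw [quadratic_gaussSum_prime_shift hp hpN, mul_assoc, I_mul_im, re_ofReal_mul]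
  exact mul_nonneg (by positivity) (re_one_add_pow_mul_nonneg hu N)

/-! ### The sign of the Gauss sum of the Kronecker character. -/

namespace TwistedMordell

open Complex

theorem kroneckerSymbol_prime (a : ℤ) {p : ℕ} (hp : p.Prime) (hp2 : p ≠ 2) :
    kroneckerSymbol a p = jacobiSym a p := by
  have h : p.factorization 2 = 0 := by
    refine Nat.factorization_eq_zero_of_not_dvd fun h => hp2 ?_
    exact ((Nat.prime_dvd_prime_iff_eq Nat.prime_two hp).1 h).symm
  have h0 : (p : ℤ) ≠ 0 := by exact_mod_cast hp.ne_zero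
  have h1 : ¬ ((p : ℤ) < 0 ∧ a < 0) := by omega
  rw [kroneckerSymbol, if_neg h0, if_neg h1, Int.natAbs_natCast, h]
  simp

theorem kroneckerSymbol_neg_one {a : ℤ} (ha : a < 0) : kroneckerSymbol a (-1) = -1 := by
  simp [kroneckerSymbol, ha]

/-- For fixed `x` the sum over `a` is `g(χ) χ(x²)`, and `χ²` is the trivial character. This writes
`g` through quadratic Gauss sums, with no factorisation of `N`. -/
theorem gaussSum_mul_sum_sq {N : ℕ} [NeZero N] {χ : DirichletCharacter ℂ N}
    (hχ : χ.IsPrimitive) (hr : χ⁻¹ = χ) :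
    ∑ a : ZMod N, χ a * ∑ x : ZMod N, ZMod.stdAddChar (a * x ^ 2)
      = gaussSum χ ZMod.stdAddChar * (Nat.card (ZMod N)ˣ : ℂ) := by
  have h1 : ∀ x : ZMod N, ∑ a : ZMod N, χ a * ZMod.stdAddChar (a * x ^ 2)
      = gaussSum χ ZMod.stdAddChar * (χ * χ⁻¹) x := by
    intro x
    have := gaussSum_mulShift_of_isPrimitive ZMod.stdAddChar hχ (x ^ 2)
    rw [gaussSum] at this
    simp only [AddChar.mulShift_apply] at this
    rw [hr, map_pow] at this
    rw [hr, MulChar.mul_apply, ← sq, mul_comm, ← this]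
    exact Finset.sum_congr rfl fun a _ => by rw [mul_comm a]
  simp_rw [Finset.mul_sum]
  rw [Finset.sum_comm]
  simp_rw [h1, mul_inv_cancel]
  rw [← Finset.mul_sum, MulChar.sum_one_eq_card_units]
  simp

theorem gauss_of_kroneckerSymbol {N : ℕ} (hN : 3 ≤ N) {χ : DirichletCharacter ℂ N}
    (hχ : χ.IsPrimitive)
    (hK : ∀ n : ℤ, χ (n : ZMod N) = (kroneckerSymbol (-(N : ℤ)) n : ℂ)) :
    gauss χ = I * Real.sqrt N ∧ star χ = χ ∧ χ (-1) = -1 := by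
  have : NeZero N := ⟨by omega⟩
  have hodd : χ (-1) = -1 := by
    have := hK (-1)
    rw [kroneckerSymbol_neg_one (by omega)] at this
    simpa using this
  have hstar : star χ = χ := by
    ext a
    obtain ⟨n, hn⟩ := ZMod.intCast_surjective (a : ZMod N)
    rw [MulChar.star_apply, ← hn, hK]
    simp
  have hinv : χ⁻¹ = χ := by rw [← MulChar.star_eq_inv, hstar]
  refine ⟨?_, hstar, hodd⟩
  rw [gauss_eq_gaussSum (by omega)]
  set g := gaussSum χ ZMod.stdAddChar with hg
  have hsq : g ^ 2 = (I * Real.sqrt N) ^ 2 := by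
    have := hχ.gaussSum_mul_gaussSum_inv
    rw [hinv, hodd, ← hg] at this
    have h2 : (Real.sqrt N : ℂ) ^ 2 = N := by
      rw [← ofReal_pow, Real.sq_sqrt (Nat.cast_nonneg N), ofReal_natCast]
    rw [mul_pow, I_sq, h2]
    linear_combination this
  have him : 0 ≤ (g * (Nat.card (ZMod N)ˣ : ℂ)).im := by
    rw [hg, ← gaussSum_mul_sum_sq hχ hinv, im_sum]
    refine Finset.sum_nonneg fun a _ => ?_
    by_cases ha : IsUnit a
    · obtain ⟨p, hp2, hp, rfl⟩ := Nat.forall_exists_prime_gt_and_eq_mod ha 2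
      have : Fact p.Prime := ⟨hp⟩
      have hpN : ¬ p ∣ N := by
        have h := (ZMod.isUnit_iff_coprime p N).1 ha
        exact (Nat.Prime.coprime_iff_not_dvd hp).1 h
      have h := hK p
      rw [kroneckerSymbol_prime _ hp hp2.ne', Int.cast_natCast] at h
      rw [h]
      exact im_jacobiSym_mul_nonneg hp2.ne' hpN
    · rw [χ.map_nonunit ha, zero_mul, zero_im]
  rcases sq_eq_sq_iff_eq_or_eq_neg.1 hsq with h | h
  · exact h
  · exfalso
    have hc : (0:ℝ) < (Nat.card (ZMod N)ˣ : ℝ) := by exact_mod_cast Nat.card_pos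
    have hs : 0 < Real.sqrt N := sqrt_natCast_pos hN
    rw [← ofReal_natCast, im_mul_ofReal, h] at him
    simp only [neg_im, I_mul_im, ofReal_re, neg_mul] at him
    linarith [mul_pos hs hc]

/-- For an odd character `Phi χ` is even away from `0`, so `x ↦ -x` absorbs the sign of `z`. -/
theorem h_neg {N : ℕ} (hN : 3 ≤ N) {χ : DirichletCharacter ℂ N} (hodd : χ (-1) = -1) (z τ : ℂ) :
    h χ (-z) τ = h χ z τ := by
  rw [h, h, ← integral_neg_eq_self]
  refine integral_congr_ae ?_
  filter_upwards [compl_mem_ae_iff.2 (measure_singleton (0:ℝ))] with x hx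
  rw [integrand, integrand, Phi_neg (by omega) χ hx, hodd, neg_neg, one_mul]
  congr 2
  push_cast
  ring

end TwistedMordell

theorem theorem1p3 (N : ℕ) (hN : 3 ≤ N) :
    (∀ χ : DirichletCharacter ℂ N, χ.IsPrimitive →
      TwistedMordell.gauss (star χ) ≠ 0 ∧
      ∀ τ : ℂ, 0 < τ.im → ∀ z : ℂ,
        Integrable (TwistedMordell.integrand χ z τ) ∧
        TwistedMordell.h χ (z / τ) (-1 / τ)
          = Complex.I * (Real.sqrt N : ℂ) / TwistedMordell.gauss (star χ)
            * Complex.exp (-(Real.pi * Complex.I * z ^ 2 / τ))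
            * (-Complex.I * τ) ^ (1 / 2 : ℂ)
            * TwistedMordell.h (star χ) (-z) τ) ∧
    (∀ χN : DirichletCharacter ℂ N, χN.IsPrimitive →
      (∀ n : ℤ, χN (n : ZMod N) = (TwistedMordell.kroneckerSymbol (-(N : ℤ)) n : ℂ)) →
      ∀ τ : ℂ, 0 < τ.im → ∀ z : ℂ,
        TwistedMordell.h χN (z / τ) (-1 / τ)
          = Complex.exp (-(Real.pi * Complex.I * z ^ 2 / τ))
            * (-Complex.I * τ) ^ (1 / 2 : ℂ)
            * TwistedMordell.h χN z τ) := by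
  refine ⟨fun χ hχ => ⟨TwistedMordell.gauss_ne_zero (by omega) (TwistedMordell.star_isPrimitive hχ),
    fun τ hτ z => ⟨TwistedMordell.integrable_integrand hN hχ hτ z,
      TwistedMordell.h_neg_div hN hχ hτ z⟩⟩, fun χ hχ hK τ hτ z => ?_⟩
  obtain ⟨hg, hstar, hodd⟩ := TwistedMordell.gauss_of_kroneckerSymbol hN hχ hK
  have hg0 := TwistedMordell.gauss_ne_zero (by omega) hχ
  rw [TwistedMordell.h_neg_div hN hχ hτ z, hstar, TwistedMordell.h_neg hN hodd, ← hg, div_self hg0,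
    one_mul]
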